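/- Let $(M^n,g)$ be a time- and space-oriented Lorentzian spin manifold of dimension $n\geq 3$ with signature $(-,+,\dots,+)$ and a fixed spin structure, let $\mathcal{S}$ be its complex spinor bundle (associated to the standard complex spinor module of dimension $2^{\lfloor n/2\rfloor}$), with Clifford multiplication satisfying $X\cdot Y\cdot\varphi+Y\cdot X\cdot\varphi=-2g(X,Y)\varphi$, let $\nabla^{\mathcal S}$ be the spinor derivative induced by the Levi-Civita connection, and let $\mathcal{D}\varphi=\sum_a\varepsilon_a\, e_a\cdot\nabla^{\mathcal S}_{e_a}\varphi$ be the Dirac operator, where $(e_a)$ is a local orthonormal frame and $\varepsilon_a=g(e_a,e_a)$. Let $\phi\in\Gamma(\mathcal{S})$ be a smooth conformal Killing spinor, i.e. $\nabla^{\mathcal S}_X\phi+\frac1n X\cdot\mathcal{D}\phi=0$ for all $X\in TM$, and let $\mathrm{zero}(\phi)=\{q\in M:\phi(q)=0\}$. Let $p\in\mathrm{zero}(\phi)$, and let $\gamma_p:I\to M$ be a geodesic of $(M,g)$, defined on an open interval $I\ni 0$, with $\gamma_p(0)=p$. 1. If $\gamma_p'(0)\cdot\mathcal{D}\phi(p)=0$,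 then $\gamma_p(I)\subset\mathrm{zero}(\phi)$. 2. If $\gamma_p'(0)\cdot\mathcal{D}\phi(p)\neq 0$, then there is a $\delta>0$ such that $\phi(\gamma_p(t))\neq 0$ for all $t\in I$ with $0<|t|<\delta$; moreover, for every compact set $J\subset I$ there is a neighbourhood $U_p$ of $p$ in $M$ such that no point of $\gamma_p(J)\cap U_p$ other than $p$ is a zero of $\phi$. -/

import Mathlib

open scoped Manifold ContDiff Topology

/-! ## Linear algebra: Minkowski space, the spin group and the complex spinor module -/

namespace LorentzSpin

/-- The signs `ε₀ = -1`, `ε₁ = ⋯ = εₙ₋₁ = 1` of the scalar product of `ℝ^{1,n-1}`. -/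
noncomputable def eps {n : ℕ} (a : Fin n) : ℝ := if a.val = 0 then -1 else 1

/-- The quadratic form `x ↦ -(x, x)_{1,n-1}`. Its Clifford algebra is the one with the
convention `x · y + y · x = -2 (x, y)_{1,n-1}`. -/
noncomputable def cliffordForm (n : ℕ) : QuadraticForm ℝ (Fin n → ℝ) :=
  QuadraticMap.weightedSumSquares ℝ (fun a : Fin n => -eps a)

/-- The real Clifford algebra of `ℝ^{1,n-1}`. -/
abbrev Cl (n : ℕ) : Type := CliffordAlgebra (cliffordForm n)

/-- The Clifford element of a vector of `ℝ^{1,n-1}`. -/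
noncomputable abbrev clVec (n : ℕ) : (Fin n → ℝ) →ₗ[ℝ] Cl n := CliffordAlgebra.ι (cliffordForm n)

/-- The Clifford element of the `a`-th vector of the standard orthonormal basis. -/
noncomputable def clBasis {n : ℕ} (a : Fin n) : Cl n := clVec n (Pi.single a 1)

/-- The group `Spin_o(1,n-1)`: the products `v₁ ⋯ v₂ₖ` of vectors with
`(v₁, v₁) ⋯ (v₂ₖ, v₂ₖ) = 1`. (The normalization by `star x * x = 1` makes the number of timelike
factors even; for `n ≥ 3` the group is connected, so it is the identity component.) -/
noncomputable abbrev Spin₀ (n : ℕ) : Submonoid (Cl n) := spinGroup (cliffordForm n)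

/-- The underlying space of the standard complex spinor module `Δ_{1,n-1}`, of dimension
`2 ^ ⌊n/2⌋`, that is the `⌊n/2⌋`-fold tensor power of `ℂ²` in its standard basis. -/
abbrev Spinor (n : ℕ) : Type := (Fin (n / 2) → Bool) → ℂ

/-- The eigenvalue of the third Pauli matrix. -/
noncomputable def sgn (b : Bool) : ℂ := if b then -1 else 1

/-- Change the `j`-th entry (nothing changes if there is no such entry). -/
def flipBit {m : ℕ} (j : ℕ) (s : Fin m → Bool) : Fin m → Bool :=
  fun k => if k.val = j then !(s k) else s k

/-- The product of the signs of the first `r` entries. -/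
noncomputable def sgnProd {m : ℕ} (r : ℕ) (s : Fin m → Bool) : ℂ :=
  ∏ k : Fin m, if k.val < r then sgn (s k) else 1

/-- The `n` anticommuting involutions of `(ℂ²)^{⊗ ⌊n/2⌋}`: with the Pauli matrices `X, Y, Z`
these are `Z ⊗ ⋯ ⊗ Z ⊗ X ⊗ 1 ⊗ ⋯ ⊗ 1` for `a = 2 j` and `-Z ⊗ ⋯ ⊗ Z ⊗ Y ⊗ 1 ⊗ ⋯ ⊗ 1` for
`a = 2 j + 1` (with `j` factors `Z`), and `Z ⊗ ⋯ ⊗ Z` for the last `a` if `n` is odd. -/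
noncomputable def pauli {n : ℕ} (a : Fin n) : Module.End ℂ (Spinor n) where
  toFun f := fun s =>
    Complex.I ^ (a.val % 2) * sgnProd ((a.val + 1) / 2) s * f (flipBit (a.val / 2) s)
  map_add' f f' := by ext s; simp [mul_add]
  map_smul' c f := by ext s; simp; ring

/-- Clifford multiplication by the `a`-th standard basis vector. -/
noncomputable def gamma {n : ℕ} (a : Fin n) : Module.End ℂ (Spinor n) :=
  (if a.val = 0 then (1 : ℂ) else Complex.I) • pauli a

lemma sgn_mul_self (b : Bool) : sgn b * sgn b = 1 := by cases b <;> simp [sgn]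

lemma sgn_not (b : Bool) : sgn (!b) = -sgn b := by cases b <;> simp [sgn]

lemma flipBit_flipBit {m : ℕ} (j : ℕ) (s : Fin m → Bool) : flipBit j (flipBit j s) = s := by
  ext k; simp only [flipBit]; split_ifs <;> simp

lemma flipBit_comm {m : ℕ} (i j : ℕ) (s : Fin m → Bool) :
    flipBit i (flipBit j s) = flipBit j (flipBit i s) := by
  ext k; simp only [flipBit]; split_ifs <;> simp

lemma sgnProd_mul_self {m : ℕ} (r : ℕ) (s : Fin m → Bool) : sgnProd r s * sgnProd r s = 1 := by
  rw [sgnProd, ← Finset.prod_mul_distrib]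
  refine Finset.prod_eq_one fun k _ => ?_
  split_ifs <;> simp [sgn_mul_self]

lemma sgnProd_flipBit_of_le {m : ℕ} {r j : ℕ} (h : r ≤ j) (s : Fin m → Bool) :
    sgnProd r (flipBit j s) = sgnProd r s := by
  refine Finset.prod_congr rfl fun k _ => ?_
  by_cases hk : k.val < r
  · have : k.val ≠ j := by omega
    simp [hk, flipBit, this]
  · simp [hk]

lemma sgnProd_flipBit_of_lt {m : ℕ} {r j : ℕ} (h : j < r) (hj : j < m) (s : Fin m → Bool) :
    sgnProd r (flipBit j s) = -sgnProd r s := by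
  have key : ∀ t : Fin m → Bool, sgnProd r t = sgn (t ⟨j, hj⟩) *
      ∏ k ∈ Finset.univ.erase (⟨j, hj⟩ : Fin m), if k.val < r then sgn (t k) else 1 := by
    intro t
    rw [sgnProd, ← Finset.mul_prod_erase _ _ (Finset.mem_univ (⟨j, hj⟩ : Fin m))]
    simp [h]
  rw [key, key]
  have e : flipBit j s ⟨j, hj⟩ = !(s ⟨j, hj⟩) := by simp [flipBit]
  rw [e, sgn_not, neg_mul]
  congr 2
  refine Finset.prod_congr rfl fun k hk => ?_
  have : k.val ≠ j := fun hkj => (Finset.ne_of_mem_erase hk) (Fin.ext hkj)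
  simp [flipBit, this]

lemma pauli_sq {n : ℕ} (a : Fin n) : pauli a * pauli a = 1 := by
  refine LinearMap.ext fun f => funext fun s => ?_
  have ha := a.isLt
  simp only [Module.End.mul_apply, Module.End.one_apply, pauli, LinearMap.coe_mk, AddHom.coe_mk,
    flipBit_flipBit]
  have hs := sgnProd_mul_self ((a.val + 1) / 2) s
  rcases Nat.mod_two_eq_zero_or_one a.val with h | h
  · rw [sgnProd_flipBit_of_le (by omega), h]
    linear_combination (f s) * hs
  · rw [sgnProd_flipBit_of_lt (by omega) (by omega), h]
    linear_combination (f s) * hs -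
      (f s) * (sgnProd ((a.val + 1) / 2) s * sgnProd ((a.val + 1) / 2) s) * Complex.I_sq

lemma pauli_anticomm {n : ℕ} {a b : Fin n} (hab : a < b) :
    pauli a * pauli b = -(pauli b * pauli a) := by
  have h' : a.val < b.val := hab
  have hb := b.isLt
  refine LinearMap.ext fun f => funext fun s => ?_
  simp only [Module.End.mul_apply, LinearMap.neg_apply, Pi.neg_apply, pauli, LinearMap.coe_mk,
    AddHom.coe_mk]
  rw [sgnProd_flipBit_of_lt (r := (b.val + 1) / 2) (by omega) (by omega),
    sgnProd_flipBit_of_le (r := (a.val + 1) / 2) (by omega), flipBit_comm]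
  ring

lemma gamma_sq {n : ℕ} (a : Fin n) :
    gamma a * gamma a = (-eps a) • (1 : Module.End ℂ (Spinor n)) := by
  rw [gamma, eps, smul_mul_smul_comm, pauli_sq]
  split_ifs
  · simp
  · rw [Complex.I_mul_I]
    refine LinearMap.ext fun f => funext fun s => ?_
    simp only [LinearMap.smul_apply, Pi.smul_apply, Module.End.one_apply]
    simp

lemma gamma_anticomm {n : ℕ} {a b : Fin n} (hab : a ≠ b) :
    gamma a * gamma b + gamma b * gamma a = 0 := by
  rw [gamma, gamma, smul_mul_smul_comm, smul_mul_smul_comm,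
    mul_comm (if b.val = 0 then (1 : ℂ) else Complex.I), ← smul_add]
  rcases lt_or_gt_of_ne hab with h | h
  · rw [pauli_anticomm h, neg_add_cancel, smul_zero]
  · rw [pauli_anticomm h, add_neg_cancel, smul_zero]

/-- Clifford multiplication by a vector of `ℝ^{1,n-1}`. -/
noncomputable def gammaVec (n : ℕ) : (Fin n → ℝ) →ₗ[ℝ] Module.End ℂ (Spinor n) :=
  Fintype.linearCombination ℝ (fun a : Fin n => gamma a)

lemma gammaVec_mul_self (n : ℕ) (v : Fin n → ℝ) :
    gammaVec n v * gammaVec n v =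
      algebraMap ℝ (Module.End ℂ (Spinor n)) (cliffordForm n v) := by
  have h1 : gammaVec n v * gammaVec n v = ∑ a, ∑ b, (v a * v b) • (gamma a * gamma b) := by
    simp only [gammaVec, Fintype.linearCombination_apply, Finset.sum_mul_sum, smul_mul_smul_comm]
  have h2 : gammaVec n v * gammaVec n v = ∑ a, ∑ b, (v a * v b) • (gamma b * gamma a) := by
    rw [h1, Finset.sum_comm]
    exact Finset.sum_congr rfl fun a _ => Finset.sum_congr rfl fun b _ => by rw [mul_comm (v b)]
  have h3 : ∀ a b : Fin n, (v a * v b) • (gamma a * gamma b) + (v a * v b) • (gamma b * gamma a)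
      = if a = b then (2 * (-eps a * (v a * v a))) • (1 : Module.End ℂ (Spinor n)) else 0 := by
    intro a b
    rw [← smul_add]
    split_ifs with h
    · subst h
      rw [gamma_sq, ← two_smul ℝ, smul_smul, smul_smul]
      congr 1; ring
    · rw [gamma_anticomm h, smul_zero]
  have h4 : (2 : ℝ) • (gammaVec n v * gammaVec n v) =
      (2 : ℝ) • algebraMap ℝ (Module.End ℂ (Spinor n)) (cliffordForm n v) := by
    rw [two_smul]
    nth_rewrite 1 [h1]
    rw [h2, ← Finset.sum_add_distrib]
    simp_rw [← Finset.sum_add_distrib, h3]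
    simp only [Finset.sum_ite_eq, Finset.mem_univ, if_true, ← Finset.sum_smul, ← Finset.mul_sum]
    rw [Algebra.algebraMap_eq_smul_one, smul_smul, cliffordForm,
      QuadraticMap.weightedSumSquares_apply]
    simp only [smul_eq_mul]
  exact smul_right_injective _ (two_ne_zero (α := ℝ)) h4

/-- The action of the Clifford algebra on the spinor module; its restriction to `Spin₀ n` is the
spin representation. -/
noncomputable def rho (n : ℕ) : Cl n →ₐ[ℝ] Module.End ℂ (Spinor n) :=
  CliffordAlgebra.lift (cliffordForm n) ⟨gammaVec n, gammaVec_mul_self n⟩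

end LorentzSpin

open LorentzSpin

/-! ## Lorentzian metrics, the Levi-Civita connection and geodesics -/

/-- A smooth Lorentzian metric, of signature `(-, +, …, +)`, on an `n`-dimensional manifold. -/
structure LorentzianMetric (n : ℕ) (M : Type*) [TopologicalSpace M]
    [ChartedSpace (EuclideanSpace ℝ (Fin n)) M] [IsManifold (𝓡 n) ∞ M] where
  /-- The scalar product on the tangent space at `x`. -/
  val (x : M) : TangentSpace (𝓡 n) x →L[ℝ] TangentSpace (𝓡 n) x →L[ℝ] ℝ
  symm (x : M) (v w : TangentSpace (𝓡 n) x) : val x v w = val x w v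
  signature (x : M) : ∃ b : Module.Basis (Fin n) ℝ (TangentSpace (𝓡 n) x),
    ∀ a c, val x (b a) (b c) = if a = c then eps a else 0
  contMDiff : ContMDiff (𝓡 n)
    ((𝓡 n).prod 𝓘(ℝ, EuclideanSpace ℝ (Fin n) →L[ℝ] EuclideanSpace ℝ (Fin n) →L[ℝ] ℝ)) ∞
    (fun x ↦ Bundle.TotalSpace.mk'
      (EuclideanSpace ℝ (Fin n) →L[ℝ] EuclideanSpace ℝ (Fin n) →L[ℝ] ℝ) x (val x))

section Metric

variable {n : ℕ} {M : Type*} [TopologicalSpace M]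
  [ChartedSpace (EuclideanSpace ℝ (Fin n)) M] [IsManifold (𝓡 n) ∞ M]

namespace LorentzianMetric

/-- `g(∇_X Y, Z)` at `x` for vector fields that are smooth near `x`, where `∇` is the Levi-Civita
connection of `g`, given by Koszul's formula. -/
noncomputable def nabla (g : LorentzianMetric n M) (X Y Z : ∀ x : M, TangentSpace (𝓡 n) x)
    (x : M) : ℝ :=
  (mvfderiv (𝓡 n) (fun y => g.val y (Y y) (Z y)) x (X x)
    + mvfderiv (𝓡 n) (fun y => g.val y (Z y) (X y)) x (Y x)
    - mvfderiv (𝓡 n) (fun y => g.val y (X y) (Y y)) x (Z x)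
    + g.val x (VectorField.mlieBracket (𝓡 n) X Y x) (Z x)
    - g.val x (VectorField.mlieBracket (𝓡 n) Y Z x) (X x)
    + g.val x (VectorField.mlieBracket (𝓡 n) Z X x) (Y x)) / 2

/-- `e₀, …, eₙ₋₁` is a smooth orthonormal frame, with `e₀` timelike, on the open set `U`. -/
structure IsOrthonormalFrameOn (g : LorentzianMetric n M) (U : Set M)
    (e : Fin n → ∀ x : M, TangentSpace (𝓡 n) x) : Prop where
  isOpen : IsOpen U
  contMDiffOn (a : Fin n) : ContMDiffOn (𝓡 n) (𝓡 n).tangent ∞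
    (fun x => (⟨x, e a x⟩ : TangentBundle (𝓡 n) M)) U
  orthonormal (x : M) (hx : x ∈ U) (a b : Fin n) :
    g.val x (e a x) (e b x) = if a = b then eps a else 0

/-- The coordinates of a tangent vector in an orthonormal frame: `v = ∑ₐ εₐ g(v, eₐ) eₐ`. -/
noncomputable def coords (g : LorentzianMetric n M) (e : Fin n → ∀ x : M, TangentSpace (𝓡 n) x)
    (x : M) (v : TangentSpace (𝓡 n) x) : Fin n → ℝ :=
  fun a => eps a * g.val x v (e a x)

end LorentzianMetric

/-- The velocity `γ'(t)` of a curve. -/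
noncomputable def velocity (n : ℕ) {M : Type*} [TopologicalSpace M]
    [ChartedSpace (EuclideanSpace ℝ (Fin n)) M] (γ : ℝ → M) (t : ℝ) :
    TangentSpace (𝓡 n) (γ t) :=
  mfderiv 𝓘(ℝ, ℝ) (𝓡 n) γ t (1 : ℝ)

/-- `γ` is a smooth geodesic of `g` on the open set `I` of parameters: `∇_{γ'} γ' = 0`. With
`γ' = ∑ₐ vᵃ eₐ` in an orthonormal frame this is
`(vᵇ)' + ∑_{a,c} vᵃ vᶜ ε_b g(∇_{eₐ} e_c, e_b) = 0` for all `b`; it is required in every local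
orthonormal frame. -/
structure LorentzianMetric.IsGeodesicOn (g : LorentzianMetric n M) (γ : ℝ → M) (I : Set ℝ) :
    Prop where
  contMDiffOn : ContMDiffOn 𝓘(ℝ, ℝ) (𝓡 n) ∞ γ I
  equation (t : ℝ) (ht : t ∈ I) (U : Set M) (hU : γ t ∈ U)
    (e : Fin n → ∀ x : M, TangentSpace (𝓡 n) x) (he : g.IsOrthonormalFrameOn U e) (b : Fin n) :
    deriv (fun s => g.coords e (γ s) (velocity n γ s) b) t
      + ∑ a, ∑ c, g.coords e (γ t) (velocity n γ t) a * g.coords e (γ t) (velocity n γ t) c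
          * (eps b * g.nabla (e a) (e c) (e b) (γ t)) = 0

/-! ## Spin structures, spinor fields and the twistor equation -/

/-- A time-orientation, a space-orientation and a spin structure on `(M, g)`, given by local
sections `sᵢ` of the spin frame bundle over an open cover `Uᵢ`: `frame i` is the orthonormal frame
under `sᵢ`, and `sⱼ = sᵢ · trans i j` with the transition functions `trans i j`, smooth with values
in `Spin_o(1,n-1)`, which satisfy the cocycle condition and lie over the transition functions of
the frames. (Since these frames differ by elements of `SO_o(1,n-1)`, they fix the two
orientations.) -/
structure SpinStructure (g : LorentzianMetric n M) (ι : Type*) where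
  U : ι → Set M
  cover (x : M) : ∃ i, x ∈ U i
  frame : ι → Fin n → ∀ x : M, TangentSpace (𝓡 n) x
  isFrame (i : ι) : g.IsOrthonormalFrameOn (U i) (frame i)
  trans : ι → ι → M → Cl n
  trans_mem (i j : ι) (x : M) (hi : x ∈ U i) (hj : x ∈ U j) : trans i j x ∈ Spin₀ n
  trans_smooth (i j : ι) (l : Module.Dual ℝ (Cl n)) :
    ContMDiffOn (𝓡 n) 𝓘(ℝ, ℝ) ∞ (fun x => l (trans i j x)) (U i ∩ U j)
  cocycle (i j k : ι) (x : M) (hi : x ∈ U i) (hj : x ∈ U j) (hk : x ∈ U k) :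
    trans i j x * trans j k x = trans i k x
  /-- `sⱼ = sᵢ · h` lies over `frame j = frame i ∘ λ(h)`, where `w = λ(h) v` means
  `h · v · h⁻¹ = w`. -/
  frame_trans (i j : ι) (x : M) (hi : x ∈ U i) (hj : x ∈ U j) (v w : Fin n → ℝ)
    (hvw : trans i j x * clVec n v = clVec n w * trans i j x) :
    ∑ a, v a • frame j a x = ∑ a, w a • frame i a x

/-- A smooth section `φ` of the spinor bundle, the bundle associated to the spin frame bundle by
the spin representation: `φ = [sᵢ, φᵢ]` over `Uᵢ` with smooth `φᵢ : Uᵢ → Δ`, where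
`[sᵢ · h, ψ] = [sᵢ, h ψ]`. (The values of `φᵢ` outside `Uᵢ` have no meaning.) -/
structure SpinorField {g : LorentzianMetric n M} {ι : Type*} (σ : SpinStructure g ι) where
  loc : ι → M → Spinor n
  smooth (i : ι) : ContMDiffOn (𝓡 n) 𝓘(ℝ, Spinor n) ∞ (loc i) (σ.U i)
  compat (i j : ι) (x : M) (hi : x ∈ σ.U i) (hj : x ∈ σ.U j) :
    loc i x = rho n (σ.trans i j x) (loc j x)

namespace SpinStructure

variable {g : LorentzianMetric n M} {ι : Type*} (σ : SpinStructure g ι)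

/-- Clifford multiplication of `ψ = [sᵢ, ψ]` by the tangent vector `X` at `x ∈ Uᵢ`. -/
noncomputable def clifford (i : ι) (x : M) (X : TangentSpace (𝓡 n) x) (ψ : Spinor n) : Spinor n :=
  rho n (clVec n (g.coords (σ.frame i) x X)) ψ

/-- The local connection form of the lifted Levi-Civita connection, with values in the Lie algebra
of the spin group: `¼ ∑_{k,l} ε_k ε_l g(∇_X e_k, e_l) e_k e_l`. -/
noncomputable def connection (i : ι) (x : M) (X : TangentSpace (𝓡 n) x) : Cl n :=
  (1 / 4 : ℝ) • ∑ k, ∑ l, (eps k * eps l *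
    ∑ c, g.coords (σ.frame i) x X c * g.nabla (σ.frame i c) (σ.frame i k) (σ.frame i l) x) •
      (clBasis k * clBasis l)

end SpinStructure

namespace SpinorField

variable {g : LorentzianMetric n M} {ι : Type*} {σ : SpinStructure g ι} (φ : SpinorField σ)

/-- The spinor derivative `∇_X φ` at `x ∈ Uᵢ`, with respect to `sᵢ`. -/
noncomputable def covDeriv (i : ι) (x : M) (X : TangentSpace (𝓡 n) x) : Spinor n :=
  mvfderiv (𝓡 n) (φ.loc i) x X + rho n (σ.connection i x X) (φ.loc i x)

/-- The Dirac operator `𝒟φ = ∑ₐ εₐ eₐ · ∇_{eₐ} φ` at `x ∈ Uᵢ`, with respect to `sᵢ`. -/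
noncomputable def dirac (i : ι) (x : M) : Spinor n :=
  ∑ a, eps a • σ.clifford i x (σ.frame i a x) (φ.covDeriv i x (σ.frame i a x))

/-- The twistor equation `∇_X φ + (1/n) X · 𝒟φ = 0` for all tangent vectors `X`. -/
def IsConformalKilling : Prop :=
  ∀ (i : ι) (x : M), x ∈ σ.U i → ∀ X : TangentSpace (𝓡 n) x,
    φ.covDeriv i x X + (1 / n : ℝ) • σ.clifford i x X (φ.dirac i x) = 0

/-- The set of zeros of `φ`. -/
def zeroSet : Set M := {x | ∀ i, x ∈ σ.U i → φ.loc i x = 0}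

end SpinorField

end Metric

/-! ### Clifford algebra: the connection form and the contracted linear system -/

namespace LorentzSpin

/-! The twistor equation is prolonged to a closed linear system, which is then restricted to a
geodesic. Write ψ = 𝒟φ, so that ∇_X φ = -(1/n) X · ψ. Differentiating once more and
antisymmetrising, torsion-freeness and the parallelism of Clifford multiplication give e_b · ∇_a ψ -
e_a · ∇_b ψ = -n R(e_a, e_b) φ. Clifford contraction solves this for ∇_a ψ when n ≥ 3
(`eq_cliffordSolve`), so ∇ψ is of order zero in φ (`frameCov_frameDirac`). The explicit Schouten
tensor is never needed, only the continuity of the coefficients.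

Along a geodesic γ put u = φ ∘ γ and w = γ' · ψ. Since ∇_{γ'} γ' = 0, the covariant derivatives of u
and w are -(1/n) w and an endomorphism applied to u (`hasDerivAt_system`). If u and w vanish at one
parameter, Grönwall's inequality gives u = 0 nearby, and connectedness of I spreads this along γ.
This is the first claim.

If u vanishes at a parameter but w does not, then u' = -(1/n) w ≠ 0 there, so the zero is isolated.
When w(0) ≠ 0, every zero on γ is of this kind, since otherwise the first claim would make φ vanish
along all of γ. Hence a compact J contains finitely many zero parameters, and their images other
than p can be removed from M to obtain the neighbourhood.

All computations take place in one local trivialisation, where spinors are vector-valued functions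
and the frame acts by a constant Clifford family `G`. -/

lemma eps_mul_self {n : ℕ} (a : Fin n) : eps a * eps a = 1 := by
  rw [eps]; split_ifs <;> norm_num

/-- The Clifford relations of Minkowski space for a family `G` in a real algebra. -/
def IsCliffordFamily {n : ℕ} {R : Type*} [Ring R] [Algebra ℝ R] (G : Fin n → R) : Prop :=
  ∀ a b, G a * G b + G b * G a = if a = b then (-2 * eps a) • (1 : R) else 0

/-- The element `¼ ∑ ε_k ε_l c_{kl} G_k G_l`. -/
noncomputable def spinConn {n : ℕ} {R : Type*} [Ring R] [Algebra ℝ R] (G : Fin n → R)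
    (c : Fin n → Fin n → ℝ) : R :=
  (1 / 4 : ℝ) • ∑ k, ∑ l, (eps k * eps l * c k l) • (G k * G l)

section Algebra

variable {n : ℕ} {R : Type*} [Ring R] [Algebra ℝ R] {G : Fin n → R}

lemma IsCliffordFamily.sq (hG : IsCliffordFamily G) (a : Fin n) :
    G a * G a = (-eps a) • (1 : R) := by
  have h := hG a a
  rw [if_pos rfl, ← two_smul ℝ] at h
  refine smul_right_injective R (two_ne_zero (α := ℝ)) ?_
  simp only [h, smul_smul]
  congr 1; ring

lemma IsCliffordFamily.swap (hG : IsCliffordFamily G) (a b : Fin n) :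
    G a * G b = -(G b * G a) + if a = b then (-2 * eps a) • (1 : R) else 0 := by
  rw [← hG a b]; abel

/-- Moving `G b` through the pair from either side produces the same triple product -G_k G_b G_l,
which cancels; only the contractions of the Clifford relations survive. -/
lemma IsCliffordFamily.pair_commutator (hG : IsCliffordFamily G) (k l b : Fin n) :
    G k * G l * G b - G b * (G k * G l) =
      (if l = b then (-2 * eps b) • G k else 0) + if k = b then (2 * eps b) • G l else 0 := by
  have h1 : G k * G l * G b = -(G k * G b * G l) + if l = b then (-2 * eps b) • G k else 0 := by
    rw [mul_assoc, hG.swap l b, mul_add, mul_neg, mul_assoc]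
    split_ifs with h
    · subst h; simp
    · simp
  have h2 : G b * (G k * G l) = -(G k * G b * G l) - if k = b then (2 * eps b) • G l else 0 := by
    rw [← mul_assoc, hG.swap b k, add_mul, neg_mul]
    by_cases h : k = b
    · subst h; simp [sub_eq_add_neg]
    · simp [h, Ne.symm h]
  rw [h1, h2]; abel

/-- The commutator of the connection form with a Clifford generator is the rotation given by
the coefficients of the form. -/
lemma IsCliffordFamily.spinConn_commutator (hG : IsCliffordFamily G) {c : Fin n → Fin n → ℝ}
    (hc : ∀ k l, c k l = -c l k) (b : Fin n) :
    spinConn G c * G b - G b * spinConn G c = ∑ l, (eps l * c b l) • G l := by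
  have h : spinConn G c * G b - G b * spinConn G c = (1 / 4 : ℝ) • ∑ k, ∑ l,
      (eps k * eps l * c k l) • (G k * G l * G b - G b * (G k * G l)) := by
    simp only [spinConn, smul_mul_assoc, mul_smul_comm, Finset.sum_mul, Finset.mul_sum, smul_sub,
      Finset.sum_sub_distrib]
  -- By antisymmetry of `c` both contractions give the same sum with factor 2; together they cancel
  -- the 1/4 of `spinConn`.
  have e1 : ∑ k, ∑ l, (eps k * eps l * c k l) • (if l = b then (-2 * eps b) • G k else 0) =
      ∑ l, (2 * (eps l * c b l)) • G l := by
    refine Finset.sum_congr rfl fun k _ => ?_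
    rw [Finset.sum_eq_single b (fun l _ hl => by simp [hl]) (by simp), if_pos rfl, smul_smul,
      hc k b]
    congr 1
    linear_combination 2 * eps k * c b k * eps_mul_self b
  have e2 : ∑ k, ∑ l, (eps k * eps l * c k l) • (if k = b then (2 * eps b) • G l else 0) =
      ∑ l, (2 * (eps l * c b l)) • G l := by
    rw [Finset.sum_comm]
    refine Finset.sum_congr rfl fun l _ => ?_
    rw [Finset.sum_eq_single b (fun l _ hl => by simp [hl]) (by simp), if_pos rfl, smul_smul]
    congr 1
    linear_combination 2 * eps l * c b l * eps_mul_self b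
  rw [h]
  simp_rw [hG.pair_commutator, smul_add, Finset.sum_add_distrib]
  rw [e1, e2, ← two_smul ℝ, smul_smul, Finset.smul_sum]
  refine Finset.sum_congr rfl fun l _ => ?_
  rw [smul_smul]; congr 1; ring

lemma IsCliffordFamily.sum_eps_smul_sq (hG : IsCliffordFamily G) :
    ∑ b, eps b • (G b * G b) = (-n : ℝ) • (1 : R) := by
  simp_rw [hG.sq, smul_smul, mul_neg, eps_mul_self]
  simp [← Nat.cast_smul_eq_nsmul ℝ]

/-- The solution operators of the system `G_b P_a - G_a P_b = r_{ab}`. -/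
noncomputable def cliffordSolve (G : Fin n → R) (r : Fin n → Fin n → R) (a : Fin n) : R :=
  (1 / (2 - n) : ℝ) • (∑ b, eps b • (G b * r a b)
    - (1 / (2 - 2 * n) : ℝ) • (G a * ∑ c, ∑ b, (eps c * eps b) • (G c * G b * r c b)))

variable {F : Type*} [AddCommGroup F] [Module ℝ F] [Module R F] [IsScalarTower ℝ R F]

/-- For `n ≥ 3` the system `G_b P_a - G_a P_b = r_{ab} f` determines `P`. -/
lemma IsCliffordFamily.eq_cliffordSolve [SMulCommClass R ℝ F] (hG : IsCliffordFamily G)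
    (hn : 3 ≤ n) {P : Fin n → F}
    {r : Fin n → Fin n → R} {f : F} (h : ∀ a b, G b • P a - G a • P b = r a b • f) (a : Fin n) :
    P a = cliffordSolve G r a • f := by
  have hn' : (3 : ℝ) ≤ n := by exact_mod_cast hn
  -- Contracting the system with ε_b G_b gives (2 - n) P_a + G_a Q, and contracting this again with
  -- ε_a G_a gives (2 - 2n) Q. Both factors are nonzero for n ≥ 3, so first Q and then P_a can be
  -- recovered.
  set Q : F := ∑ b, eps b • (G b • P b) with hQ
  have h1 : ∀ a, (2 - n : ℝ) • P a + G a • Q = ∑ b, eps b • (G b • r a b • f) := by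
    intro a
    have e1 : ∑ b, eps b • (G b • G b • P a) = (-n : ℝ) • P a := by
      have := congrArg (· • P a) hG.sum_eps_smul_sq
      simpa only [Finset.sum_smul, smul_assoc, mul_smul, one_smul] using this
    have e2 : ∀ b, eps b • (G b • G a • P b) =
        -(G a • eps b • G b • P b) + if b = a then (-2 : ℝ) • P a else 0 := by
      intro b
      rw [← mul_smul, hG.swap b a, add_smul, smul_add, neg_smul, smul_neg, mul_smul,
        smul_comm (eps b) (G a)]
      congr 1
      split_ifs with hb
      · subst hb
        rw [smul_assoc, one_smul, smul_smul]
        congr 1; linear_combination (-2) * eps_mul_self b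
      · simp
    simp_rw [← h, smul_sub, Finset.sum_sub_distrib, e1, e2, Finset.sum_add_distrib]
    simp only [Finset.sum_neg_distrib, Finset.sum_ite_eq', Finset.mem_univ, if_true,
      ← Finset.smul_sum, ← hQ]
    generalize G a • Q = q
    module
  have h2 : (2 - 2 * n : ℝ) • Q = ∑ c, ∑ b, (eps c * eps b) • (G c • G b • r c b • f) := by
    have e1 : ∑ c, eps c • (G c • ((2 - n : ℝ) • P c + G c • Q)) = (2 - 2 * n : ℝ) • Q := by
      have e : ∑ c, eps c • (G c • G c • Q) = (-n : ℝ) • Q := by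
        have := congrArg (· • Q) hG.sum_eps_smul_sq
        simpa only [Finset.sum_smul, smul_assoc, mul_smul, one_smul] using this
      simp_rw [smul_add, Finset.sum_add_distrib, e, smul_comm (G _) (2 - n : ℝ),
        smul_comm (eps _) (2 - n : ℝ), ← Finset.smul_sum, ← hQ]
      module
    rw [← e1]
    simp_rw [h1, Finset.smul_sum, smul_comm (G _) (eps _), smul_smul]
  have h3 : P a = (1 / (2 - n) : ℝ) • ((2 - n : ℝ) • P a + G a • Q
      - (1 / (2 - 2 * n) : ℝ) • G a • ((2 - 2 * n : ℝ) • Q)) := by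
    rw [smul_comm (G a) (2 - 2 * n : ℝ), smul_smul, one_div_mul_cancel (by linarith), one_smul,
      add_sub_cancel_right, smul_smul, one_div_mul_cancel (by linarith), one_smul]
  rw [h3, h1, h2, cliffordSolve]
  simp only [sub_smul, smul_assoc, mul_smul, Finset.sum_smul, Finset.smul_sum,
    smul_sub]

end Algebra

end LorentzSpin

/-! ### Smooth vector fields: derivatives of functions and Lie brackets -/

section VectorFields

open Bundle VectorField

variable {n : ℕ} {M : Type*} [TopologicalSpace M]
  [ChartedSpace (EuclideanSpace ℝ (Fin n)) M] [IsManifold (𝓡 n) ∞ M]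
  {F : Type*} [NormedAddCommGroup F] [NormedSpace ℝ F]

/-- The derivative is the fibre component of the tangent map of `f` composed with the section `V`.
-/
lemma ContMDiffOn.mvfderiv_apply {f : M → F} {U : Set M} (hU : IsOpen U)
    (hf : ContMDiffOn (𝓡 n) 𝓘(ℝ, F) ∞ f U) {V : ∀ x : M, TangentSpace (𝓡 n) x}
    (hV : ContMDiffOn (𝓡 n) (𝓡 n).tangent ∞ (fun x => (⟨x, V x⟩ : TangentBundle (𝓡 n) M)) U) :
    ContMDiffOn (𝓡 n) 𝓘(ℝ, F) ∞ (fun x => mvfderiv (𝓡 n) f x (V x)) U := by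
  have h1 := (hf.contMDiffOn_tangentMapWithin (m := ∞) le_rfl hU.uniqueMDiffOn).comp hV
    (fun x hx => hx)
  have h2 := (contMDiff_snd_tangentBundle_modelSpace F 𝓘(ℝ, F) (n := ∞)).comp_contMDiffOn h1
  refine h2.congr fun x hx => ?_
  change (mfderiv (𝓡 n) 𝓘(ℝ, F) f x) (V x) = (mfderivWithin (𝓡 n) 𝓘(ℝ, F) f U x) (V x)
  rw [mfderivWithin_of_isOpen hU hx]

omit [IsManifold (𝓡 n) ∞ M] in
lemma Filter.EventuallyEq.mvfderiv_eq {f f' : M → F} {x : M} (h : f =ᶠ[𝓝 x] f')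
    (v : TangentSpace (𝓡 n) x) : mvfderiv (𝓡 n) f x v = mvfderiv (𝓡 n) f' x v := by
  change mfderiv (𝓡 n) 𝓘(ℝ, F) f x v = mfderiv (𝓡 n) 𝓘(ℝ, F) f' x v
  rw [h.mfderiv_eq]
  rfl

omit [IsManifold (𝓡 n) ∞ M] in
lemma MDifferentiableAt.mvfderiv_clm_comp {F' : Type*} [NormedAddCommGroup F'] [NormedSpace ℝ F']
    {f : M → F} {x : M} (L : F →L[ℝ] F') (hf : MDifferentiableAt (𝓡 n) 𝓘(ℝ, F) f x)
    (v : TangentSpace (𝓡 n) x) :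
    mvfderiv (𝓡 n) (fun y => L (f y)) x v = L (mvfderiv (𝓡 n) f x v) := by
  have h := mfderiv_comp_apply (I := 𝓡 n) (I' := 𝓘(ℝ, F)) (I'' := 𝓘(ℝ, F')) (f := f) (g := L) x
    L.differentiableAt.mdifferentiableAt hf v
  rw [mfderiv_eq_fderiv, ContinuousLinearMap.fderiv] at h
  exact h

lemma ContMDiffOn.mlieBracket {U : Set M} (hU : IsOpen U) {V W : ∀ x : M, TangentSpace (𝓡 n) x}
    (hV : ContMDiffOn (𝓡 n) (𝓡 n).tangent ∞ (fun x => (⟨x, V x⟩ : TangentBundle (𝓡 n) M)) U)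
    (hW : ContMDiffOn (𝓡 n) (𝓡 n).tangent ∞ (fun x => (⟨x, W x⟩ : TangentBundle (𝓡 n) M)) U) :
    ContMDiffOn (𝓡 n) (𝓡 n).tangent ∞
      (fun x => (⟨x, mlieBracket (𝓡 n) V W x⟩ : TangentBundle (𝓡 n) M)) U := by
  intro x hx
  have : IsManifold (𝓡 n) (((⊤ : ℕ∞) : ℕ∞ω) + 1) M := ‹IsManifold (𝓡 n) ∞ M›
  have : IsManifold (𝓡 n) (minSmoothness ℝ 2) M := by
    rw [minSmoothness_of_isRCLikeNormedField]
    exact IsManifold.of_le (n := ∞) (WithTop.coe_le_coe.2 le_top : ((2 : ℕ∞) : ℕ∞ω) ≤ ∞)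
  refine (ContMDiffAt.mlieBracket_vectorField (m := ⊤) (n := ⊤) (hV.contMDiffAt (hU.mem_nhds hx))
    (hW.contMDiffAt (hU.mem_nhds hx)) ?_).contMDiffWithinAt
  rw [minSmoothness_of_isRCLikeNormedField]
  exact le_rfl

/-- On functions, the Lie bracket acts as the commutator of derivations. -/
lemma mvfderiv_mlieBracket {f : M → ℝ} {U : Set M} (hU : IsOpen U) {x : M} (hx : x ∈ U)
    (hf : ContMDiffOn (𝓡 n) 𝓘(ℝ, ℝ) ∞ f U) {V W Z : ∀ x : M, TangentSpace (𝓡 n) x}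
    (hV : ContMDiffOn (𝓡 n) (𝓡 n).tangent ∞ (fun x => (⟨x, V x⟩ : TangentBundle (𝓡 n) M)) U)
    (hW : ContMDiffOn (𝓡 n) (𝓡 n).tangent ∞ (fun x => (⟨x, W x⟩ : TangentBundle (𝓡 n) M)) U)
    (hZ : ContMDiffOn (𝓡 n) (𝓡 n).tangent ∞ (fun x => (⟨x, Z x⟩ : TangentBundle (𝓡 n) M)) U)
    (hZx : Z x ≠ 0) :
    mvfderiv (𝓡 n) f x (mlieBracket (𝓡 n) V W x) =
      mvfderiv (𝓡 n) (fun y => mvfderiv (𝓡 n) f y (W y)) x (V x) -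
      mvfderiv (𝓡 n) (fun y => mvfderiv (𝓡 n) f y (V y)) x (W x) := by
  have at' : ∀ {A : ∀ x : M, TangentSpace (𝓡 n) x},
      ContMDiffOn (𝓡 n) (𝓡 n).tangent ∞ (fun x => (⟨x, A x⟩ : TangentBundle (𝓡 n) M)) U →
      ContMDiffAt (𝓡 n) (𝓡 n).tangent ∞ (fun x => (⟨x, A x⟩ : TangentBundle (𝓡 n) M)) x :=
    fun h => h.contMDiffAt (hU.mem_nhds hx)
  have md : ∀ {A : ∀ x : M, TangentSpace (𝓡 n) x}, ∀ y ∈ U,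
      ContMDiffOn (𝓡 n) (𝓡 n).tangent ∞ (fun x => (⟨x, A x⟩ : TangentBundle (𝓡 n) M)) U →
      MDifferentiableAt (𝓡 n) (𝓡 n).tangent (fun x => (⟨x, A x⟩ : TangentBundle (𝓡 n) M)) y :=
    fun y hy h => (h.contMDiffAt (hU.mem_nhds hy)).mdifferentiableAt (by simp)
  have mf : ∀ {f : M → ℝ}, ∀ y ∈ U, ContMDiffOn (𝓡 n) 𝓘(ℝ, ℝ) ∞ f U →
      MDifferentiableAt (𝓡 n) 𝓘(ℝ, ℝ) f y :=
    fun y hy h => (h.contMDiffAt (hU.mem_nhds hy)).mdifferentiableAt (by simp)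
  have hfZ : ContMDiffOn (𝓡 n) (𝓡 n).tangent ∞
      (fun x => (⟨x, (f • Z) x⟩ : TangentBundle (𝓡 n) M)) U := hf.smul_section hZ
  have lhs : ∀ {A : ∀ x : M, TangentSpace (𝓡 n) x},
      ContMDiffOn (𝓡 n) (𝓡 n).tangent ∞ (fun x => (⟨x, A x⟩ : TangentBundle (𝓡 n) M)) U →
      ∀ {B : ∀ x : M, TangentSpace (𝓡 n) x},
      ContMDiffOn (𝓡 n) (𝓡 n).tangent ∞ (fun x => (⟨x, B x⟩ : TangentBundle (𝓡 n) M)) U →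
      mlieBracket (𝓡 n) A (mlieBracket (𝓡 n) B (f • Z)) x =
        mvfderiv (𝓡 n) (fun y => mvfderiv (𝓡 n) f y (B y)) x (A x) • Z x
        + mvfderiv (𝓡 n) f x (B x) • mlieBracket (𝓡 n) A Z x
        + (mvfderiv (𝓡 n) f x (A x) • mlieBracket (𝓡 n) B Z x
        + f x • mlieBracket (𝓡 n) A (mlieBracket (𝓡 n) B Z) x) := by
    intro A hA B hB
    have e : mlieBracket (𝓡 n) B (f • Z) =ᶠ[𝓝 x]
        (fun y => mvfderiv (𝓡 n) f y (B y)) • Z + f • mlieBracket (𝓡 n) B Z := by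
      filter_upwards [hU.mem_nhds hx] with y hy
      exact mlieBracket_smul_right (mf y hy hf) (md y hy hZ)
    have hB' := hf.mvfderiv_apply hU hB
    have hBZ := hB.mlieBracket hU hZ
    rw [Filter.EventuallyEq.rfl.mlieBracket_vectorField_eq e,
      mlieBracket_add_right (md x hx (hB'.smul_section hZ)) (md x hx (hf.smul_section hBZ)),
      mlieBracket_smul_right (mf x hx hB') (md x hx hZ),
      mlieBracket_smul_right (mf x hx hf) (md x hx hBZ)]
  have : IsManifold (𝓡 n) (minSmoothness ℝ 3) M := by
    rw [minSmoothness_of_isRCLikeNormedField]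
    exact IsManifold.of_le (n := ∞) (WithTop.coe_le_coe.2 le_top : ((3 : ℕ∞) : ℕ∞ω) ≤ ∞)
  have h2 : minSmoothness ℝ 2 ≤ (∞ : WithTop ℕ∞) := by
    rw [minSmoothness_of_isRCLikeNormedField]
    exact (WithTop.coe_le_coe.2 le_top : ((2 : ℕ∞) : ℕ∞ω) ≤ ∞)
  have jac : ∀ {B : ∀ x : M, TangentSpace (𝓡 n) x},
      ContMDiffOn (𝓡 n) (𝓡 n).tangent ∞ (fun x => (⟨x, B x⟩ : TangentBundle (𝓡 n) M)) U →
      mlieBracket (𝓡 n) V (mlieBracket (𝓡 n) W B) x =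
        mlieBracket (𝓡 n) (mlieBracket (𝓡 n) V W) B x
        + mlieBracket (𝓡 n) W (mlieBracket (𝓡 n) V B) x := fun hB =>
    leibniz_identity_mlieBracket_apply ((at' hV).of_le h2) ((at' hW).of_le h2) ((at' hB).of_le h2)
  -- Expand the Jacobi identity for V, W, fZ by the Leibniz rule. The mixed terms are symmetric in V
  -- and W and cancel, and f times the Jacobi identity for Z removes the double brackets. What
  -- remains is the claim multiplied by Z x, which is nonzero.
  have key := jac hfZ
  rw [lhs hV hW, lhs hW hV, mlieBracket_smul_right (mf x hx hf) (md x hx hZ), jac hZ] at key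
  refine smul_left_injective ℝ hZx ?_
  simp only [sub_smul]
  rw [eq_sub_iff_add_eq, ← sub_eq_zero]
  rw [← sub_eq_zero] at key
  rw [← neg_eq_zero, ← key]
  module

end VectorFields

/-! ### The Levi-Civita connection in an orthonormal frame -/

section Metric

open Bundle VectorField

variable {n : ℕ} {M : Type*} [TopologicalSpace M]
  [ChartedSpace (EuclideanSpace ℝ (Fin n)) M] [IsManifold (𝓡 n) ∞ M]

/-- The scalar product of two smooth vector fields along a smooth map is smooth. -/
lemma LorentzianMetric.contMDiffWithinAt_val (g : LorentzianMetric n M)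
    {E' : Type*} [NormedAddCommGroup E'] [NormedSpace ℝ E'] {H' : Type*} [TopologicalSpace H']
    {J : ModelWithCorners ℝ E' H'} {N : Type*} [TopologicalSpace N] [ChartedSpace H' N]
    {b : N → M} {v w : ∀ y : N, TangentSpace (𝓡 n) (b y)} {s : Set N} {y : N}
    (hb : ContMDiffWithinAt J (𝓡 n) ∞ b s y)
    (hv : ContMDiffWithinAt J (𝓡 n).tangent ∞ (fun y => (⟨b y, v y⟩ : TangentBundle (𝓡 n) M)) s y)
    (hw : ContMDiffWithinAt J (𝓡 n).tangent ∞ (fun y => (⟨b y, w y⟩ : TangentBundle (𝓡 n) M)) s y) :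
    ContMDiffWithinAt J 𝓘(ℝ, ℝ) ∞ (fun y => g.val (b y) (v y) (w y)) s y := by
  have : ContMDiffWithinAt J ((𝓡 n).prod 𝓘(ℝ)) ∞
      (fun m ↦ TotalSpace.mk' ℝ (E := Bundle.Trivial M ℝ) (b m) (g.val (b m) (v m) (w m))) s y := by
    apply ContMDiffWithinAt.clm_bundle_apply₂ (F₁ := EuclideanSpace ℝ (Fin n))
      (F₂ := EuclideanSpace ℝ (Fin n))
    · exact ContMDiffAt.comp_contMDiffWithinAt y g.contMDiff.contMDiffAt hb
    · exact hv
    · exact hw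
  simp only [contMDiffWithinAt_totalSpace] at this
  exact this.2

namespace LorentzianMetric.IsOrthonormalFrameOn

variable {g : LorentzianMetric n M} {U : Set M} {e : Fin n → ∀ x : M, TangentSpace (𝓡 n) x}

lemma contMDiffOn_val (he : g.IsOrthonormalFrameOn U e) {V : ∀ x : M, TangentSpace (𝓡 n) x}
    (hV : ContMDiffOn (𝓡 n) (𝓡 n).tangent ∞ (fun x => (⟨x, V x⟩ : TangentBundle (𝓡 n) M)) U)
    (a : Fin n) :
    ContMDiffOn (𝓡 n) 𝓘(ℝ, ℝ) ∞ (fun x => g.val x (V x) (e a x)) U :=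
  fun x hx => g.contMDiffWithinAt_val contMDiffWithinAt_id (hV x hx) (he.contMDiffOn a x hx)

lemma coords_frame (he : g.IsOrthonormalFrameOn U e) {x : M} (hx : x ∈ U) (a c : Fin n) :
    g.coords e x (e a x) c = if a = c then 1 else 0 := by
  rw [coords, he.orthonormal x hx]
  split_ifs with h
  · rw [h, eps_mul_self]
  · simp

lemma linearIndependent (he : g.IsOrthonormalFrameOn U e) {x : M} (hx : x ∈ U) :
    LinearIndependent ℝ (fun a => e a x) := by
  rw [Fintype.linearIndependent_iff]
  intro c hc b
  have h : g.val x (∑ a, c a • e a x) (e b x) = 0 := by rw [hc]; simp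
  rw [map_sum, sum_apply] at h
  simp only [map_smul, smul_apply, he.orthonormal x hx, smul_eq_mul, mul_ite,
    mul_zero, Finset.sum_ite_eq', Finset.mem_univ, if_true] at h
  have := eps_mul_self b
  rcases mul_eq_zero.1 h with h | h
  · exact h
  · rw [h] at this; norm_num at this

lemma sum_coords_smul (he : g.IsOrthonormalFrameOn U e) {x : M} (hx : x ∈ U)
    (v : TangentSpace (𝓡 n) x) : ∑ a, g.coords e x v a • e a x = v := by
  have : FiniteDimensional ℝ (TangentSpace (𝓡 n) x) :=
    inferInstanceAs (FiniteDimensional ℝ (EuclideanSpace ℝ (Fin n)))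
  have hspan := (he.linearIndependent hx).span_eq_top_of_card_eq_finrank'
    (by rw [Fintype.card_fin]; exact (finrank_euclideanSpace_fin (𝕜 := ℝ) (n := n)).symm)
  have hv : v ∈ Submodule.span ℝ (Set.range fun a => e a x) := by rw [hspan]; trivial
  obtain ⟨c, rfl⟩ := (Submodule.mem_span_range_iff_exists_fun ℝ).1 hv
  refine Finset.sum_congr rfl fun b _ => ?_
  congr 1
  rw [coords, map_sum, sum_apply]
  simp only [map_smul, smul_apply, he.orthonormal x hx, smul_eq_mul, mul_ite,
    mul_zero, Finset.sum_ite_eq', Finset.mem_univ, if_true]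
  linear_combination c b * eps_mul_self b

/-- The scalar products of the frame fields are locally constant, so the derivative terms of
Koszul's formula vanish. -/
lemma nabla_eq (he : g.IsOrthonormalFrameOn U e) {x : M} (hx : x ∈ U) (a k l : Fin n) :
    g.nabla (e a) (e k) (e l) x = (g.val x (mlieBracket (𝓡 n) (e a) (e k) x) (e l x)
      - g.val x (mlieBracket (𝓡 n) (e k) (e l) x) (e a x)
      + g.val x (mlieBracket (𝓡 n) (e l) (e a) x) (e k x)) / 2 := by
  have h : ∀ b c : Fin n, mvfderiv (𝓡 n) (fun y => g.val y (e b y) (e c y)) x = 0 := by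
    intro b c
    have h1 : (fun y => g.val y (e b y) (e c y)) =ᶠ[𝓝 x]
        fun _ => if b = c then eps b else (0 : ℝ) := by
      filter_upwards [he.isOpen.mem_nhds hx] with y hy
      exact he.orthonormal y hy b c
    ext v
    rw [h1.mvfderiv_eq, mvfderiv_const]
  rw [nabla, h, h, h]
  simp

/-- Metric compatibility, in the form required by `spinConn_commutator`. -/
lemma nabla_antisymm (he : g.IsOrthonormalFrameOn U e) {x : M} (hx : x ∈ U) (a k l : Fin n) :
    g.nabla (e a) (e k) (e l) x = -g.nabla (e a) (e l) (e k) x := by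
  rw [he.nabla_eq hx, he.nabla_eq hx, mlieBracket_swap_apply (V := e l) (W := e k),
    mlieBracket_swap_apply (V := e a) (W := e l), mlieBracket_swap_apply (V := e k) (W := e a)]
  simp only [map_neg, neg_apply]
  ring

/-- Vanishing torsion in frame components. -/
lemma nabla_sub_nabla (he : g.IsOrthonormalFrameOn U e) {x : M} (hx : x ∈ U) (a b c : Fin n) :
    eps c * (g.nabla (e a) (e b) (e c) x - g.nabla (e b) (e a) (e c) x) =
      g.coords e x (mlieBracket (𝓡 n) (e a) (e b) x) c := by
  rw [he.nabla_eq hx, he.nabla_eq hx, coords, mlieBracket_swap_apply (V := e b) (W := e a),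
    mlieBracket_swap_apply (V := e a) (W := e c), mlieBracket_swap_apply (V := e c) (W := e b)]
  simp only [map_neg, neg_apply]
  ring

lemma contMDiffOn_nabla (he : g.IsOrthonormalFrameOn U e) (a k l : Fin n) :
    ContMDiffOn (𝓡 n) 𝓘(ℝ, ℝ) ∞ (fun x => g.nabla (e a) (e k) (e l) x) U := by
  have h := fun b c d => he.contMDiffOn_val
    ((he.contMDiffOn b).mlieBracket he.isOpen (he.contMDiffOn c)) d
  have h' := (((h a k l).sub (h k l a)).add (h l a k)).smul
    (contMDiffOn_const (I := 𝓡 n) (I' := 𝓘(ℝ, ℝ)) (c := (1 / 2 : ℝ)))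
  refine h'.congr fun x hx => ?_
  rw [he.nabla_eq hx]
  exact div_eq_mul_one_div _ _

/-- The derivatives along the frame commute up to the torsion-free structure coefficients. -/
lemma mvfderiv_commutator (he : g.IsOrthonormalFrameOn U e) {F : Type*} [NormedAddCommGroup F]
    [NormedSpace ℝ F] {f : M → F} (hf : ContMDiffOn (𝓡 n) 𝓘(ℝ, F) ∞ f U) {x : M} (hx : x ∈ U)
    (a b : Fin n) :
    mvfderiv (𝓡 n) (fun y => mvfderiv (𝓡 n) f y (e b y)) x (e a x)
      - mvfderiv (𝓡 n) (fun y => mvfderiv (𝓡 n) f y (e a y)) x (e b x) =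
      ∑ c, (eps c * (g.nabla (e a) (e b) (e c) x - g.nabla (e b) (e a) (e c) x)) •
        mvfderiv (𝓡 n) f x (e c x) := by
  have h1 : ∑ c, (eps c * (g.nabla (e a) (e b) (e c) x - g.nabla (e b) (e a) (e c) x)) •
        mvfderiv (𝓡 n) f x (e c x) =
      mvfderiv (𝓡 n) f x (mlieBracket (𝓡 n) (e a) (e b) x) := by
    conv_rhs => rw [← he.sum_coords_smul hx (mlieBracket (𝓡 n) (e a) (e b) x), map_sum]
    simp_rw [he.nabla_sub_nabla hx, map_smul]
  -- Testing against continuous functionals reduces the vector-valued case to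
  -- `mvfderiv_mlieBracket`; the nowhere vanishing auxiliary field there is `e a`.
  rw [h1, SeparatingDual.eq_iff_forall_dual_eq (R := ℝ)]
  intro L
  have md : ∀ {f : M → F}, ∀ y ∈ U, ContMDiffOn (𝓡 n) 𝓘(ℝ, F) ∞ f U →
      MDifferentiableAt (𝓡 n) 𝓘(ℝ, F) f y :=
    fun y hy h => (h.contMDiffAt (he.isOpen.mem_nhds hy)).mdifferentiableAt (by simp)
  have hLf : ContMDiffOn (𝓡 n) 𝓘(ℝ, ℝ) ∞ (fun y => L (f y)) U :=
    L.contDiff.contMDiff.comp_contMDiffOn hf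
  have h2 : ∀ c d : Fin n, L (mvfderiv (𝓡 n) (fun y => mvfderiv (𝓡 n) f y (e c y)) x (e d x)) =
      mvfderiv (𝓡 n) (fun y => mvfderiv (𝓡 n) (fun z => L (f z)) y (e c y)) x (e d x) := by
    intro c d
    rw [← (md x hx (hf.mvfderiv_apply he.isOpen (he.contMDiffOn c))).mvfderiv_clm_comp L]
    have : (fun y => L (mvfderiv (𝓡 n) f y (e c y))) =ᶠ[𝓝 x]
        fun y => mvfderiv (𝓡 n) (fun z => L (f z)) y (e c y) := by
      filter_upwards [he.isOpen.mem_nhds hx] with y hy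
      rw [(md y hy hf).mvfderiv_clm_comp L]
    exact this.mvfderiv_eq _
  rw [map_sub, h2, h2, ← (md x hx hf).mvfderiv_clm_comp L]
  exact (mvfderiv_mlieBracket he.isOpen hx hLf (he.contMDiffOn a) (he.contMDiffOn b)
    (he.contMDiffOn a) ((he.linearIndependent hx).ne_zero a)).symm

end LorentzianMetric.IsOrthonormalFrameOn

end Metric

lemma LorentzSpin.clm_mul_apply {F : Type*} [NormedAddCommGroup F] [NormedSpace ℝ F]
    (A B : F →L[ℝ] F) (v : F) : (A * B) v = A (B v) := rfl

/-! ### Prolongation of the twistor equation in an orthonormal frame -/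

section Prolongation

open Bundle VectorField

variable {n : ℕ} {M : Type*} [TopologicalSpace M]
  [ChartedSpace (EuclideanSpace ℝ (Fin n)) M]
  {F F' : Type*} [NormedAddCommGroup F] [NormedSpace ℝ F] [NormedAddCommGroup F'] [NormedSpace ℝ F']

/-- The product rule, read in the preferred chart at `x`; it differentiates the connection form
applied to a spinor. -/
lemma MDifferentiableAt.mvfderiv_clm_apply {A : M → F →L[ℝ] F'} {f : M → F} {x : M}
    (hA : MDifferentiableAt (𝓡 n) 𝓘(ℝ, F →L[ℝ] F') A x)
    (hf : MDifferentiableAt (𝓡 n) 𝓘(ℝ, F) f x) (v : TangentSpace (𝓡 n) x) :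
    mvfderiv (𝓡 n) (fun y => A y (f y)) x v =
      mvfderiv (𝓡 n) A x v (f x) + A x (mvfderiv (𝓡 n) f x v) := by
  have h := hA.clm_apply hf
  rw [h.mvfderiv, hA.mvfderiv, hf.mvfderiv]
  have hA' := hA.differentiableWithinAt_writtenInExtChartAt
  have hf' := hf.differentiableWithinAt_writtenInExtChartAt
  have hu : UniqueDiffWithinAt ℝ (Set.range (𝓡 n)) (extChartAt (𝓡 n) x x) :=
    (𝓡 n).uniqueDiffOn _ (Set.mem_range_self _)
  have e := congrArg (· v) (fderivWithin_clm_apply hu hA' hf')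
  simp only [writtenInExtChartAt, extChartAt_model_space_eq_id] at *
  simp only [mfld_simps] at e ⊢
  refine e.trans ?_
  simp only [fderivWithin_univ]
  exact add_comm _ _

variable [IsManifold (𝓡 n) ∞ M]

namespace LorentzianMetric

/-- The connection form of the lifted Levi-Civita connection in the direction `e a`. -/
noncomputable def frameConn (g : LorentzianMetric n M) (e : Fin n → ∀ x : M, TangentSpace (𝓡 n) x)
    (G : Fin n → F →L[ℝ] F) (a : Fin n) (x : M) : F →L[ℝ] F :=
  spinConn G fun k l => g.nabla (e a) (e k) (e l) x

/-- The covariant derivative in the direction `e a`. -/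
noncomputable def frameCov (g : LorentzianMetric n M) (e : Fin n → ∀ x : M, TangentSpace (𝓡 n) x)
    (G : Fin n → F →L[ℝ] F) (f : M → F) (a : Fin n) (x : M) : F :=
  mvfderiv (𝓡 n) f x (e a x) + g.frameConn e G a x (f x)

/-- The Dirac operator in an orthonormal frame. -/
noncomputable def frameDirac (g : LorentzianMetric n M)
    (e : Fin n → ∀ x : M, TangentSpace (𝓡 n) x) (G : Fin n → F →L[ℝ] F) (f : M → F) (x : M) : F :=
  ∑ a, eps a • G a (g.frameCov e G f a x)

/-- The curvature of the lifted Levi-Civita connection in an orthonormal frame. -/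
noncomputable def frameCurv (g : LorentzianMetric n M)
    (e : Fin n → ∀ x : M, TangentSpace (𝓡 n) x) (G : Fin n → F →L[ℝ] F) (a b : Fin n) (x : M) :
    F →L[ℝ] F :=
  mvfderiv (𝓡 n) (g.frameConn e G b) x (e a x) - mvfderiv (𝓡 n) (g.frameConn e G a) x (e b x)
    + (g.frameConn e G a x * g.frameConn e G b x - g.frameConn e G b x * g.frameConn e G a x)
    - ∑ c, (eps c * (g.nabla (e a) (e b) (e c) x - g.nabla (e b) (e a) (e c) x)) •
        g.frameConn e G c x

namespace IsOrthonormalFrameOn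

variable {g : LorentzianMetric n M} {U : Set M} {e : Fin n → ∀ x : M, TangentSpace (𝓡 n) x}
  {G : Fin n → F →L[ℝ] F} {f : M → F}

lemma contMDiffOn_frameConn (he : g.IsOrthonormalFrameOn U e) (a : Fin n) :
    ContMDiffOn (𝓡 n) 𝓘(ℝ, F →L[ℝ] F) ∞ (g.frameConn e G a) U := by
  have h : ∀ k l, ContMDiffOn (𝓡 n) 𝓘(ℝ, F →L[ℝ] F) ∞
      (fun x => (eps k * eps l * g.nabla (e a) (e k) (e l) x) • (G k * G l)) U := fun k l =>
    ((contMDiffOn_const (I := 𝓡 n) (I' := 𝓘(ℝ, ℝ))).mul (he.contMDiffOn_nabla a k l)).smul contMDiffOn_const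
  exact (contMDiffOn_const (I := 𝓡 n) (I' := 𝓘(ℝ, ℝ)) (c := (1 / 4 : ℝ))).smul
    (contMDiffOn_finsetSum fun k _ => contMDiffOn_finsetSum fun l _ => h k l)

lemma contMDiffOn_frameCov (he : g.IsOrthonormalFrameOn U e)
    (hf : ContMDiffOn (𝓡 n) 𝓘(ℝ, F) ∞ f U) (a : Fin n) :
    ContMDiffOn (𝓡 n) 𝓘(ℝ, F) ∞ (g.frameCov e G f a) U :=
  (hf.mvfderiv_apply he.isOpen (he.contMDiffOn a)).add ((he.contMDiffOn_frameConn a).clm_apply hf)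

lemma contMDiffOn_frameDirac (he : g.IsOrthonormalFrameOn U e)
    (hf : ContMDiffOn (𝓡 n) 𝓘(ℝ, F) ∞ f U) :
    ContMDiffOn (𝓡 n) 𝓘(ℝ, F) ∞ (g.frameDirac e G f) U :=
  contMDiffOn_finsetSum fun a _ => (contMDiffOn_const (I := 𝓡 n) (I' := 𝓘(ℝ, ℝ))).smul
    ((G a).contDiff.contMDiff.comp_contMDiffOn (he.contMDiffOn_frameCov hf a))

lemma continuousOn_frameCurv (he : g.IsOrthonormalFrameOn U e) (a b : Fin n) :
    ContinuousOn (g.frameCurv e G a b) U := by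
  have h1 : ∀ c, ContinuousOn (g.frameConn e G c) U := fun c =>
    (he.contMDiffOn_frameConn c).continuousOn
  have h2 : ∀ c d, ContinuousOn
      (fun x => mvfderiv (𝓡 n) (g.frameConn e G c) x (e d x)) U := fun c d =>
    ((he.contMDiffOn_frameConn c).mvfderiv_apply he.isOpen (he.contMDiffOn d)).continuousOn
  have h3 : ∀ a b c, ContinuousOn (fun x => g.nabla (e a) (e b) (e c) x) U := fun a b c =>
    (he.contMDiffOn_nabla a b c).continuousOn
  refine (((h2 b a).sub (h2 a b)).add (((h1 a).mul (h1 b)).sub ((h1 b).mul (h1 a)))).sub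
    (continuousOn_finsetSum _ fun c _ => ?_)
  exact (continuousOn_const.mul ((h3 a b c).sub (h3 b a c))).smul (h1 c)

lemma mdifferentiableAt_of_mem (he : g.IsOrthonormalFrameOn U e)
    (hf : ContMDiffOn (𝓡 n) 𝓘(ℝ, F) ∞ f U) {x : M} (hx : x ∈ U) :
    MDifferentiableAt (𝓡 n) 𝓘(ℝ, F) f x :=
  (hf.contMDiffAt (he.isOpen.mem_nhds hx)).mdifferentiableAt (by simp)

/-- The Ricci identity. -/
lemma frameCov_commutator (he : g.IsOrthonormalFrameOn U e)
    (hf : ContMDiffOn (𝓡 n) 𝓘(ℝ, F) ∞ f U) {x : M} (hx : x ∈ U) (a b : Fin n) :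
    g.frameCov e G (g.frameCov e G f b) a x - g.frameCov e G (g.frameCov e G f a) b x
      - ∑ c, (eps c * (g.nabla (e a) (e b) (e c) x - g.nabla (e b) (e a) (e c) x)) •
        g.frameCov e G f c x = g.frameCurv e G a b x (f x) := by
  have h : ∀ c d, g.frameCov e G (g.frameCov e G f c) d x =
      mvfderiv (𝓡 n) (fun y => mvfderiv (𝓡 n) f y (e c y)) x (e d x)
      + (mvfderiv (𝓡 n) (g.frameConn e G c) x (e d x) (f x)
        + g.frameConn e G c x (mvfderiv (𝓡 n) f x (e d x)))
      + g.frameConn e G d x (mvfderiv (𝓡 n) f x (e c x) + g.frameConn e G c x (f x)) := by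
    intro c d
    have hA := he.mdifferentiableAt_of_mem (he.contMDiffOn_frameConn (G := G) c) hx
    have hf' := he.mdifferentiableAt_of_mem hf hx
    have hD := he.mdifferentiableAt_of_mem (hf.mvfderiv_apply he.isOpen (he.contMDiffOn c)) hx
    rw [← hA.mvfderiv_clm_apply hf']
    have := congrArg (· (e d x)) (mvfderiv_add hD (hA.clm_apply hf'))
    exact congrArg (· + _) this
  rw [h, h]
  have hc := he.mvfderiv_commutator hf hx a b
  rw [sub_eq_iff_eq_add] at hc
  rw [hc]
  simp only [frameCov, frameCurv, smul_add, Finset.sum_add_distrib, map_add, sub_apply, add_apply,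
    sum_apply, smul_apply, LorentzSpin.clm_mul_apply]
  abel

/-- The second half of the prolongation of the twistor equation: the covariant derivative of the
Dirac derivative of a conformal Killing spinor is of order zero in the spinor. -/
lemma frameCov_frameDirac (he : g.IsOrthonormalFrameOn U e) (hG : IsCliffordFamily G)
    (hn : 3 ≤ n) (hf : ContMDiffOn (𝓡 n) 𝓘(ℝ, F) ∞ f U)
    (htw : ∀ x ∈ U, ∀ a, g.frameCov e G f a x + (1 / n : ℝ) • G a (g.frameDirac e G f x) = 0)
    {x : M} (hx : x ∈ U) (a : Fin n) :
    g.frameCov e G (g.frameDirac e G f) a x =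
      cliffordSolve G (fun a b => (-n : ℝ) • g.frameCurv e G a b x) a (f x) := by
  have hn0 : (n : ℝ) ≠ 0 := by positivity
  set ψ := g.frameDirac e G f with hψ
  have hψs : ContMDiffOn (𝓡 n) 𝓘(ℝ, F) ∞ ψ U := he.contMDiffOn_frameDirac hf
  have htw' : ∀ y ∈ U, ∀ c, g.frameCov e G f c y = ((-(1 / n) : ℝ) • G c) (ψ y) := fun y hy c => by
    rw [eq_neg_of_add_eq_zero_left (htw y hy c), smul_apply, neg_smul]
  -- Clifford multiplication is parallel: ∇_d (e_c · ψ) = e_c · ∇_d ψ + (∇_d e_c) · ψ. The last term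
  -- is the commutator of the connection form with `G c`.
  have h1 : ∀ c d, g.frameCov e G (g.frameCov e G f c) d x = (-(1 / n) : ℝ) •
      (G c (g.frameCov e G ψ d x)
        + ∑ l, (eps l * g.nabla (e d) (e c) (e l) x) • G l (ψ x)) := by
    intro c d
    have e1 : g.frameCov e G f c =ᶠ[𝓝 x] fun y => ((-(1 / n) : ℝ) • G c) (ψ y) := by
      filter_upwards [he.isOpen.mem_nhds hx] with y hy using htw' y hy c
    have e2 := congrArg (· (ψ x)) (hG.spinConn_commutator (he.nabla_antisymm hx d) c)
    simp only [sub_apply, sum_apply, smul_apply, LorentzSpin.clm_mul_apply] at e2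
    rw [frameCov, e1.mvfderiv_eq, e1.eq_of_nhds,
      (he.mdifferentiableAt_of_mem hψs hx).mvfderiv_clm_comp, ← e2, frameCov]
    simp only [smul_apply, map_smul, map_add, frameConn]
    module
  -- In the Ricci identity the terms (∇_c e_d - ∇_d e_c) · ψ cancel against the torsion correction,
  -- leaving the system solved by `cliffordSolve`.
  have h2 : ∀ c d, G d (g.frameCov e G ψ c x) - G c (g.frameCov e G ψ d x) =
      ((-n : ℝ) • g.frameCurv e G c d x) (f x) := by
    intro c d
    rw [smul_apply, ← he.frameCov_commutator hf hx, h1, h1]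
    simp_rw [htw' x hx, smul_apply, smul_comm _ (-(1 / n) : ℝ), ← Finset.smul_sum, mul_sub,
      sub_smul, Finset.sum_sub_distrib, ← smul_sub, smul_smul]
    rw [show (-n : ℝ) * -(1 / n) = 1 by field_simp, one_smul]
    abel
  have : IsScalarTower ℝ (F →L[ℝ] F) F := ⟨fun _ _ _ => rfl⟩
  exact hG.eq_cliffordSolve hn (P := fun a => g.frameCov e G ψ a x)
    (r := fun a b => (-n : ℝ) • g.frameCurv e G a b x) (f := f x) h2 a

lemma continuousOn_cliffordSolve (he : g.IsOrthonormalFrameOn U e) (a : Fin n) :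
    ContinuousOn
      (fun x => cliffordSolve G (fun a b => (-n : ℝ) • g.frameCurv e G a b x) a) U := by
  have h : ∀ a b, ContinuousOn (fun x => (-n : ℝ) • g.frameCurv e G a b x) U := fun a b =>
    (continuousOn_const (c := (-n : ℝ))).smul (he.continuousOn_frameCurv a b)
  have h1 : ∀ c b, ContinuousOn
      (fun x => (eps c * eps b) • (G c * G b * ((-n : ℝ) • g.frameCurv e G c b x))) U := fun c b =>
    (continuousOn_const (c := eps c * eps b)).smul
      ((continuousOn_const (c := G c * G b)).mul (h c b))
  have h2 : ContinuousOn (fun x => ∑ b, eps b • (G b * ((-n : ℝ) • g.frameCurv e G a b x))) U :=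
    continuousOn_finsetSum _ fun b _ => (continuousOn_const (c := eps b)).smul
      ((continuousOn_const (c := G b)).mul (h a b))
  have h3 : ContinuousOn (fun x => G a * ∑ c, ∑ b,
      (eps c * eps b) • (G c * G b * ((-n : ℝ) • g.frameCurv e G c b x))) U :=
    (continuousOn_const (c := G a)).mul (continuousOn_finsetSum _ fun c _ => continuousOn_finsetSum _ fun b _ =>
      h1 c b)
  exact (continuousOn_const (c := (1 / (2 - n) : ℝ))).smul
    (h2.sub ((continuousOn_const (c := (1 / (2 - 2 * n) : ℝ))).smul h3))

end IsOrthonormalFrameOn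

end LorentzianMetric

end Prolongation

/-! ### Uniqueness for linear differential equations -/

section LinearODE

variable {F : Type*} [NormedAddCommGroup F] [NormedSpace ℝ F]

/-- Grönwall's inequality forward in time; the backward direction follows by the reflection t ↦ -t.
-/
lemma eq_zero_of_norm_deriv_le_mul_norm {z z' : ℝ → F} {K : ℝ} {s : Set ℝ} (hs : s.OrdConnected)
    (hz : ∀ t ∈ s, HasDerivAt z (z' t) t) (hK : ∀ t ∈ s, ‖z' t‖ ≤ K * ‖z t‖) {t₁ t : ℝ}
    (ht₁ : t₁ ∈ s) (ht : t ∈ s) (h : z t₁ = 0) : z t = 0 := by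
  rcases le_total t₁ t with hle | hle
  · have hsub : Set.Icc t₁ t ⊆ s := hs.out ht₁ ht
    exact eq_zero_of_abs_deriv_le_mul_abs_self_of_eq_zero_right (K := K) (f' := z')
      (fun x hx => (hz x (hsub hx)).continuousAt.continuousWithinAt)
      (fun x hx => (hz x (hsub (Set.Ico_subset_Icc_self hx))).hasDerivWithinAt) h
      (fun x hx => hK x (hsub (Set.Ico_subset_Icc_self hx))) t (Set.right_mem_Icc.2 hle)
  · have hsub : ∀ x ∈ Set.Icc (-t₁) (-t), -x ∈ s := fun x hx =>
      hs.out ht ht₁ ⟨by linarith [hx.2], by linarith [hx.1]⟩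
    have hd : ∀ x ∈ Set.Icc (-t₁) (-t), HasDerivAt (fun y => z (-y)) (-z' (-x)) x := fun x hx => by
      simpa [Function.comp_def] using (hz (-x) (hsub x hx)).scomp x (hasDerivAt_neg x)
    have := eq_zero_of_abs_deriv_le_mul_abs_self_of_eq_zero_right (K := K)
      (f := fun y => z (-y)) (f' := fun y => -z' (-y))
      (fun x hx => (hd x hx).continuousAt.continuousWithinAt)
      (fun x hx => (hd x (Set.Ico_subset_Icc_self hx)).hasDerivWithinAt) (by simpa using h)
      (fun x hx => by simpa using hK (-x) (hsub x (Set.Ico_subset_Icc_self hx))) (-t)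
      (Set.right_mem_Icc.2 (by linarith))
    simpa using this

/-- Local uniqueness for homogeneous linear first-order systems `u' = B w + A u`,
`w' = C u + A w`. -/
lemma exists_ball_eq_zero_of_linear_system {u w : ℝ → F} {A C : ℝ → F →L[ℝ] F} {B : F →L[ℝ] F}
    {t₀ : ℝ} (hA : ContinuousAt A t₀) (hC : ContinuousAt C t₀)
    (hu : ∀ᶠ t in 𝓝 t₀, HasDerivAt u (B (w t) + A t (u t)) t)
    (hw : ∀ᶠ t in 𝓝 t₀, HasDerivAt w (C t (u t) + A t (w t)) t) :
    ∃ δ > 0, ∀ t₁ ∈ Metric.ball t₀ δ, u t₁ = 0 → w t₁ = 0 →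
      ∀ t ∈ Metric.ball t₀ δ, u t = 0 := by
  have hA' : ∀ᶠ t in 𝓝 t₀, ‖A t‖ < ‖A t₀‖ + 1 :=
    hA.norm.eventually (Iio_mem_nhds (lt_add_one _))
  have hC' : ∀ᶠ t in 𝓝 t₀, ‖C t‖ < ‖C t₀‖ + 1 :=
    hC.norm.eventually (Iio_mem_nhds (lt_add_one _))
  -- The ball is fixed before the initial parameter `t₁` is chosen. This uniformity lets a later
  -- continuation argument start at a parameter close to `t₀`.
  obtain ⟨δ, hδ, h⟩ := Metric.eventually_nhds_iff_ball.1 (hu.and (hw.and (hA'.and hC')))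
  refine ⟨δ, hδ, fun t₁ ht₁ hu₁ hw₁ t ht => ?_⟩
  have key := eq_zero_of_norm_deriv_le_mul_norm (z := fun s => (u s, w s))
    (z' := fun s => (B (w s) + A s (u s), C s (u s) + A s (w s)))
    -- The sum of the bounds for the two rows dominates their maximum, which is the norm on the
    -- product.
    (K := (‖B‖ + (‖A t₀‖ + 1)) + ((‖C t₀‖ + 1) + (‖A t₀‖ + 1))) (s := Metric.ball t₀ δ)
    (convex_ball t₀ δ).ordConnected (fun s hs => (h s hs).1.prodMk (h s hs).2.1)
    (fun s hs => ?_) ht₁ ht (by simp [hu₁, hw₁])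
  · exact congrArg Prod.fst key
  · obtain ⟨-, -, ha, hc⟩ := h s hs
    have hu' : ‖u s‖ ≤ ‖(u s, w s)‖ := norm_fst_le (u s, w s)
    have hw' : ‖w s‖ ≤ ‖(u s, w s)‖ := norm_snd_le (u s, w s)
    have e1 : ‖B (w s)‖ ≤ ‖B‖ * ‖(u s, w s)‖ := B.le_opNorm_of_le hw'
    have e2 : ‖A s (u s)‖ ≤ (‖A t₀‖ + 1) * ‖(u s, w s)‖ :=
      (A s).le_of_opNorm_le_of_le ha.le hu'
    have e3 : ‖C s (u s)‖ ≤ (‖C t₀‖ + 1) * ‖(u s, w s)‖ :=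
      (C s).le_of_opNorm_le_of_le hc.le hu'
    have e4 : ‖A s (w s)‖ ≤ (‖A t₀‖ + 1) * ‖(u s, w s)‖ :=
      (A s).le_of_opNorm_le_of_le ha.le hw'
    refine (norm_prod_le_iff.2 ⟨?_, ?_⟩)
    · refine (norm_add_le _ _).trans ?_
      have : 0 ≤ (‖C t₀‖ + 1 + (‖A t₀‖ + 1)) * ‖(u s, w s)‖ := by positivity
      linarith
    · refine (norm_add_le _ _).trans ?_
      have : 0 ≤ (‖B‖ + (‖A t₀‖ + 1)) * ‖(u s, w s)‖ := by positivity
      linarith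

end LinearODE

/-- The index form of ∇_{γ'} γ' = 0: differentiating the components of γ' produces Christoffel terms
opposite to those from moving the connection form past Clifford multiplication. Here `T x a` stands
for e_x · ∇_a ψ, `S a x` for the connection form in direction a applied to e_x · ψ, and `h l` for
e_l · ψ. -/
lemma LorentzSpin.sum_geodesic_cancel {n : ℕ} {F : Type*} [AddCommGroup F] [Module ℝ F]
    (v : Fin n → ℝ) (T S : Fin n → Fin n → F) (h : Fin n → F) (Γ : Fin n → Fin n → Fin n → ℝ) :
    ∑ x, (v x • ∑ a, v a • (T x a - (S a x - ∑ l, (eps l * Γ a x l) • h l))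
      + (-∑ a, ∑ c, v a * v c * (eps x * Γ a c x)) • h x) =
    ∑ x, ∑ a, (v x * v a) • T x a + ∑ x, v x • -∑ a, v a • S a x := by
  have e : ∑ x, (∑ a, ∑ c, v a * v c * (eps x * Γ a c x)) • h x =
      ∑ x, v x • ∑ a, v a • ∑ l, (eps l * Γ a x l) • h l := by
    simp only [Finset.sum_smul, Finset.smul_sum, smul_smul]
    rw [Finset.sum_comm, Finset.sum_comm (γ := Fin n) (s := Finset.univ) (t := Finset.univ)
      (f := fun x a => ∑ l, (v x * (v a * (eps l * Γ a x l))) • h l)]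
    refine Finset.sum_congr rfl fun a _ => ?_
    rw [Finset.sum_comm]
    refine Finset.sum_congr rfl fun c _ => Finset.sum_congr rfl fun l _ => ?_
    congr 1; ring
  simp only [Finset.sum_add_distrib, neg_smul, Finset.sum_neg_distrib, e, smul_sub, smul_neg,
    Finset.sum_sub_distrib]
  simp only [Finset.smul_sum, smul_smul]
  abel

/-! ### The linear system along a geodesic -/

section Curve

open Bundle

variable {n : ℕ} {M : Type*} [TopologicalSpace M]
  [ChartedSpace (EuclideanSpace ℝ (Fin n)) M] {F : Type*} [NormedAddCommGroup F] [NormedSpace ℝ F]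

lemma hasDerivAt_comp_curve {γ : ℝ → M} {f : M → F} {t : ℝ}
    (hf : MDifferentiableAt (𝓡 n) 𝓘(ℝ, F) f (γ t))
    (hγ : MDifferentiableAt 𝓘(ℝ, ℝ) (𝓡 n) γ t) :
    HasDerivAt (fun s => f (γ s)) (mvfderiv (𝓡 n) f (γ t) (velocity n γ t)) t := by
  have h : HasFDerivAt (fun s => f (γ s))
      ((mvfderiv (𝓡 n) f (γ t)).comp (mfderiv 𝓘(ℝ, ℝ) (𝓡 n) γ t) : ℝ →L[ℝ] F) t :=
    hasMFDerivAt_iff_hasFDerivAt.1 (hf.hasMFDerivAt.comp t hγ.hasMFDerivAt)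
  exact h.hasDerivAt

variable [IsManifold (𝓡 n) ∞ M]

lemma ContMDiffOn.velocity {γ : ℝ → M} {I : Set ℝ} (hI : IsOpen I)
    (hγ : ContMDiffOn 𝓘(ℝ, ℝ) (𝓡 n) ∞ γ I) :
    ContMDiffOn 𝓘(ℝ, ℝ) (𝓡 n).tangent ∞
      (fun s => (⟨γ s, velocity n γ s⟩ : TangentBundle (𝓡 n) M)) I := by
  have h0 : ContMDiffOn 𝓘(ℝ, ℝ) 𝓘(ℝ, ℝ).tangent ∞
      (fun s : ℝ => (⟨s, (1 : ℝ)⟩ : TangentBundle 𝓘(ℝ, ℝ) ℝ)) I := fun s _ =>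
    contMDiffWithinAt_vectorSpace_iff_contDiffWithinAt.2 contDiffWithinAt_const
  refine ((hγ.contMDiffOn_tangentMapWithin (m := ∞) le_rfl hI.uniqueMDiffOn).comp h0
    (fun x hx => hx)).congr fun s hs => ?_
  simp only [Function.comp_apply, tangentMapWithin, mfderivWithin_of_isOpen hI hs]
  rfl

namespace LorentzianMetric.IsOrthonormalFrameOn

variable {g : LorentzianMetric n M} {U : Set M} {e : Fin n → ∀ x : M, TangentSpace (𝓡 n) x}
  {G : Fin n → F →L[ℝ] F} {f : M → F}

lemma differentiableAt_coords_velocity (he : g.IsOrthonormalFrameOn U e) {γ : ℝ → M} {I : Set ℝ}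
    (hI : IsOpen I) (hγ : ContMDiffOn 𝓘(ℝ, ℝ) (𝓡 n) ∞ γ I) {t : ℝ} (ht : t ∈ I) (hU : γ t ∈ U)
    (b : Fin n) : DifferentiableAt ℝ (fun s => g.coords e (γ s) (velocity n γ s) b) t := by
  have hγt := hγ t ht
  have h1 : ContMDiffWithinAt 𝓘(ℝ, ℝ) (𝓡 n).tangent ∞
      (fun s => (⟨γ s, e b (γ s)⟩ : TangentBundle (𝓡 n) M)) I t :=
    (((he.contMDiffOn b).contMDiffAt (he.isOpen.mem_nhds hU)).comp_contMDiffWithinAt t hγt :)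
  have h2 := g.contMDiffWithinAt_val hγt ((hγ.velocity hI) t ht) h1
  have h3 := (h2.contMDiffAt (hI.mem_nhds ht)).contDiffAt.differentiableAt (by simp)
  exact h3.const_mul _

/-- Along a geodesic `γ`, a conformal Killing spinor `f` and `γ' · 𝒟f` solve a homogeneous linear
system. -/
lemma hasDerivAt_system (he : g.IsOrthonormalFrameOn U e) (hG : IsCliffordFamily G)
    (hn : 3 ≤ n) (hf : ContMDiffOn (𝓡 n) 𝓘(ℝ, F) ∞ f U)
    (htw : ∀ x ∈ U, ∀ a, g.frameCov e G f a x + (1 / n : ℝ) • G a (g.frameDirac e G f x) = 0)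
    {γ : ℝ → M} {I : Set ℝ} (hI : IsOpen I) (hγ : g.IsGeodesicOn γ I) {t : ℝ} (ht : t ∈ I)
    (hU : γ t ∈ U) :
    HasDerivAt (fun s => f (γ s))
      (((-(1 / n) : ℝ) • (1 : F →L[ℝ] F))
          (∑ b, g.coords e (γ t) (velocity n γ t) b • G b (g.frameDirac e G f (γ t)))
        + (-∑ a, g.coords e (γ t) (velocity n γ t) a • g.frameConn e G a (γ t)) (f (γ t))) t ∧
    HasDerivAt
      (fun s => ∑ b, g.coords e (γ s) (velocity n γ s) b • G b (g.frameDirac e G f (γ s)))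
      ((∑ b, ∑ a, (g.coords e (γ t) (velocity n γ t) b * g.coords e (γ t) (velocity n γ t) a) •
          (G b * cliffordSolve G (fun a b => (-n : ℝ) • g.frameCurv e G a b (γ t)) a)) (f (γ t))
        + (-∑ a, g.coords e (γ t) (velocity n γ t) a • g.frameConn e G a (γ t))
          (∑ b, g.coords e (γ t) (velocity n γ t) b • G b (g.frameDirac e G f (γ t)))) t := by
  have hγt : MDifferentiableAt 𝓘(ℝ, ℝ) (𝓡 n) γ t :=
    (hγ.contMDiffOn.contMDiffAt (hI.mem_nhds ht)).mdifferentiableAt (by simp)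
  set v := g.coords e (γ t) (velocity n γ t) with hv
  have hvel : ∑ a, v a • e a (γ t) = velocity n γ t := he.sum_coords_smul hU _
  -- The ordinary derivative along γ is the covariant one minus the connection form, expanded in the
  -- frame components of γ'.
  have chain : ∀ {h : M → F}, ContMDiffOn (𝓡 n) 𝓘(ℝ, F) ∞ h U →
      HasDerivAt (fun s => h (γ s))
        (∑ a, v a • (g.frameCov e G h a (γ t) - g.frameConn e G a (γ t) (h (γ t)))) t := by
    intro h hh
    have := hasDerivAt_comp_curve (he.mdifferentiableAt_of_mem hh hU) hγt
    rw [← hvel, map_sum] at this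
    simp only [map_smul] at this
    simpa only [frameCov, add_sub_cancel_right] using this
  have hψ : ContMDiffOn (𝓡 n) 𝓘(ℝ, F) ∞ (g.frameDirac e G f) U := he.contMDiffOn_frameDirac hf
  constructor
  · convert chain hf using 1
    simp only [fun a => eq_neg_of_add_eq_zero_left (htw _ hU a), smul_sub, Finset.sum_sub_distrib,
      smul_apply, neg_apply, sum_apply, one_apply_eq_self, smul_neg, neg_smul,
      Finset.sum_neg_distrib, Finset.smul_sum, smul_comm _ (1 / n : ℝ)]
    abel
  · have hc : ∀ b, HasDerivAt (fun s => g.coords e (γ s) (velocity n γ s) b)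
        (-∑ a, ∑ c, v a * v c * (eps b * g.nabla (e a) (e c) (e b) (γ t))) t := by
      intro b
      have h1 := (he.differentiableAt_coords_velocity hI hγ.contMDiffOn ht hU b).hasDerivAt
      rwa [eq_neg_of_add_eq_zero_left (hγ.equation t ht U hU e he b)] at h1
    have hd := HasDerivAt.fun_sum (u := Finset.univ) fun b _ =>
      (hc b).smul ((G b).hasFDerivAt.comp_hasDerivAt t (chain hψ))
    refine hd.congr_deriv ?_
    have hcomm : ∀ a b, G b (g.frameConn e G a (γ t) (g.frameDirac e G f (γ t))) =
        g.frameConn e G a (γ t) (G b (g.frameDirac e G f (γ t)))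
        - ∑ l, (eps l * g.nabla (e a) (e b) (e l) (γ t)) • G l (g.frameDirac e G f (γ t)) := by
      intro a b
      have e2 := congrArg (· (g.frameDirac e G f (γ t)))
        (hG.spinConn_commutator (he.nabla_antisymm hU a) b)
      simp only [sub_apply, sum_apply, smul_apply, LorentzSpin.clm_mul_apply] at e2
      rw [← e2, frameConn, sub_sub_cancel]
    simp only [he.frameCov_frameDirac hG hn hf htw hU, map_sum, map_smul, map_sub, hcomm,
      smul_apply, neg_apply, sum_apply, LorentzSpin.clm_mul_apply]
    exact sum_geodesic_cancel v (fun x a => G x (cliffordSolve G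
        (fun a b => (-n : ℝ) • g.frameCurv e G a b (γ t)) a (f (γ t))))
      (fun a x => g.frameConn e G a (γ t) (G x (g.frameDirac e G f (γ t))))
      (fun x => G x (g.frameDirac e G f (γ t))) fun a b c => g.nabla (e a) (e b) (e c) (γ t)

end LorentzianMetric.IsOrthonormalFrameOn

end Curve

/-! ### The spinor module as a concrete Clifford family -/

namespace LorentzSpin

variable {n : ℕ}

/-- Clifford multiplication by a standard basis vector as a continuous real-linear map. -/
noncomputable def gammaCLM (a : Fin n) : Spinor n →L[ℝ] Spinor n :=
  LinearMap.toContinuousLinearMap ((gamma a).restrictScalars ℝ)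

lemma gammaCLM_apply (a : Fin n) (ψ : Spinor n) : gammaCLM a ψ = gamma a ψ := rfl

lemma isCliffordFamily_gammaCLM : IsCliffordFamily (gammaCLM (n := n)) := by
  intro a b
  ext1 ψ
  change gamma a (gamma b ψ) + gamma b (gamma a ψ) = _
  split_ifs with h
  · subst h
    have := congrArg (· ψ) (gamma_sq a)
    simp only [Module.End.mul_apply, LinearMap.smul_apply, Module.End.one_apply] at this
    rw [this, smul_apply, one_apply_eq_self]
    module
  · exact congrArg (· ψ) (gamma_anticomm h)

lemma rho_clVec_apply (v : Fin n → ℝ) (ψ : Spinor n) :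
    rho n (clVec n v) ψ = ∑ a, v a • gammaCLM a ψ := by
  rw [rho, clVec, CliffordAlgebra.lift_ι_apply, gammaVec, Fintype.linearCombination_apply,
    LinearMap.sum_apply]
  rfl

lemma rho_clBasis (a : Fin n) : rho n (clBasis a) = gamma a := by
  refine LinearMap.ext fun ψ => ?_
  rw [clBasis, rho_clVec_apply, Finset.sum_eq_single a (fun b _ hb => by simp [hb]) (by simp)]
  simp [gammaCLM_apply]

end LorentzSpin

/-! ### Zeros of a conformal Killing spinor along a geodesic -/

section Spinors

variable {n : ℕ} {M : Type*} [TopologicalSpace M]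
  [ChartedSpace (EuclideanSpace ℝ (Fin n)) M] [IsManifold (𝓡 n) ∞ M]
  {g : LorentzianMetric n M} {ι : Type*} {σ : SpinStructure g ι}

lemma SpinStructure.clifford_eq_sum (σ : SpinStructure g ι) (i : ι) (x : M)
    (X : TangentSpace (𝓡 n) x) (ψ : Spinor n) :
    σ.clifford i x X ψ = ∑ a, g.coords (σ.frame i) x X a • gammaCLM a ψ :=
  rho_clVec_apply _ _

lemma SpinStructure.clifford_frame (σ : SpinStructure g ι) {i : ι} {x : M} (hx : x ∈ σ.U i)
    (a : Fin n) (ψ : Spinor n) : σ.clifford i x (σ.frame i a x) ψ = gammaCLM a ψ := by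
  simp [σ.clifford_eq_sum, (σ.isFrame i).coords_frame hx]

lemma SpinStructure.rho_connection_frame (σ : SpinStructure g ι) {i : ι} {x : M}
    (hx : x ∈ σ.U i) (a : Fin n) (ψ : Spinor n) :
    rho n (σ.connection i x (σ.frame i a x)) ψ =
      g.frameConn (σ.frame i) gammaCLM a x ψ := by
  simp only [SpinStructure.connection, LorentzianMetric.frameConn, spinConn,
    (σ.isFrame i).coords_frame hx, ite_mul, one_mul, zero_mul, Finset.sum_ite_eq, Finset.mem_univ,
    if_true, map_smul, map_sum, map_mul, rho_clBasis, LinearMap.smul_apply, LinearMap.sum_apply,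
    Module.End.mul_apply, smul_apply, sum_apply, LorentzSpin.clm_mul_apply, gammaCLM_apply]

namespace SpinorField

variable (φ : SpinorField σ)

lemma covDeriv_frame {i : ι} {x : M} (hx : x ∈ σ.U i) (a : Fin n) :
    φ.covDeriv i x (σ.frame i a x) = g.frameCov (σ.frame i) gammaCLM (φ.loc i) a x := by
  rw [covDeriv, σ.rho_connection_frame hx, LorentzianMetric.frameCov]

lemma dirac_eq_frameDirac {i : ι} {x : M} (hx : x ∈ σ.U i) :
    φ.dirac i x = g.frameDirac (σ.frame i) gammaCLM (φ.loc i) x := by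
  simp only [dirac, LorentzianMetric.frameDirac, φ.covDeriv_frame hx, σ.clifford_frame hx]

variable {φ}

lemma IsConformalKilling.frameCov (hφ : φ.IsConformalKilling) {i : ι} {x : M} (hx : x ∈ σ.U i)
    (a : Fin n) : g.frameCov (σ.frame i) gammaCLM (φ.loc i) a x
      + (1 / n : ℝ) • gammaCLM a (g.frameDirac (σ.frame i) gammaCLM (φ.loc i) x) = 0 := by
  have := hφ i x hx (σ.frame i a x)
  rwa [φ.covDeriv_frame hx, φ.dirac_eq_frameDirac hx, σ.clifford_frame hx] at this

/-- The transition functions act linearly, so one trivialisation decides. -/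
lemma mem_zeroSet_iff {i : ι} {x : M} (hx : x ∈ σ.U i) : x ∈ φ.zeroSet ↔ φ.loc i x = 0 :=
  ⟨fun h => h i hx, fun h j hj => by rw [φ.compat j i x hj hx, h, map_zero]⟩

/-- The derivative of a conformal Killing spinor along a curve through one of its zeros. -/
lemma IsConformalKilling.hasDerivAt_of_mem_zeroSet (hφ : φ.IsConformalKilling) (hn : 3 ≤ n)
    {γ : ℝ → M} {I : Set ℝ} (hI : IsOpen I) (hγ : g.IsGeodesicOn γ I) {i : ι} {t : ℝ}
    (ht : t ∈ I) (hU : γ t ∈ σ.U i) (hz : γ t ∈ φ.zeroSet) :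
    HasDerivAt (fun s => φ.loc i (γ s))
      ((-(1 / n) : ℝ) • σ.clifford i (γ t) (velocity n γ t) (φ.dirac i (γ t))) t := by
  have h := ((σ.isFrame i).hasDerivAt_system isCliffordFamily_gammaCLM hn (φ.smooth i)
    (fun x hx => hφ.frameCov hx) hI hγ ht hU).1
  rw [hz i hU, map_zero, add_zero, ← φ.dirac_eq_frameDirac hU, ← σ.clifford_eq_sum] at h
  exact h

/-- Along a geodesic, a conformal Killing spinor `φ` is determined near `t₀` by `φ` and
`γ' · 𝒟φ` at a single parameter. -/
lemma IsConformalKilling.exists_ball_mem_zeroSet (hφ : φ.IsConformalKilling) (hn : 3 ≤ n)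
    {γ : ℝ → M} {I : Set ℝ} (hI : IsOpen I) (hγ : g.IsGeodesicOn γ I) {i : ι} {t₀ : ℝ}
    (ht₀ : t₀ ∈ I) (hU : γ t₀ ∈ σ.U i) :
    ∃ δ > 0, (∀ t ∈ Metric.ball t₀ δ, t ∈ I ∧ γ t ∈ σ.U i) ∧
      ∀ t₁ ∈ Metric.ball t₀ δ, γ t₁ ∈ φ.zeroSet →
        σ.clifford i (γ t₁) (velocity n γ t₁) (φ.dirac i (γ t₁)) = 0 →
        ∀ t ∈ Metric.ball t₀ δ, γ t ∈ φ.zeroSet := by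
  have he := σ.isFrame i
  have hγc : ContinuousAt γ t₀ := hγ.contMDiffOn.continuousOn.continuousAt (hI.mem_nhds ht₀)
  have hev : ∀ᶠ t in 𝓝 t₀, t ∈ I ∧ γ t ∈ σ.U i :=
    (hI.eventually_mem ht₀).and (hγc.eventually (he.isOpen.mem_nhds hU))
  have hsys := fun t (h : t ∈ I ∧ γ t ∈ σ.U i) =>
    he.hasDerivAt_system isCliffordFamily_gammaCLM hn (φ.smooth i)
      (fun x hx => hφ.frameCov hx) hI hγ h.1 h.2
  have hv : ∀ a, ContinuousAt
      (fun s => g.coords (σ.frame i) (γ s) (velocity n γ s) a) t₀ := fun a =>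
    (he.differentiableAt_coords_velocity hI hγ.contMDiffOn ht₀ hU a).continuousAt
  have hA : ∀ a, ContinuousAt
      (fun s => g.frameConn (σ.frame i) (gammaCLM (n := n)) a (γ s)) t₀ := fun a =>
    ((he.contMDiffOn_frameConn a).continuousOn.continuousAt (he.isOpen.mem_nhds hU)).comp hγc
  have hC : ∀ a, ContinuousAt (fun s => cliffordSolve (gammaCLM (n := n))
      (fun a b => (-n : ℝ) • g.frameCurv (σ.frame i) gammaCLM a b (γ s)) a) t₀ := fun a =>
    ((he.continuousOn_cliffordSolve (G := gammaCLM) a).continuousAt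
      (he.isOpen.mem_nhds hU)).comp (f := γ) hγc
  have hA' : ContinuousAt (fun t => -∑ a, g.coords (σ.frame i) (γ t) (velocity n γ t) a •
      g.frameConn (σ.frame i) (gammaCLM (n := n)) a (γ t)) t₀ :=
    (tendsto_finsetSum _ fun a _ => (hv a).smul (hA a)).neg
  have hC' : ContinuousAt (fun t => ∑ b, ∑ a, (g.coords (σ.frame i) (γ t) (velocity n γ t) b *
      g.coords (σ.frame i) (γ t) (velocity n γ t) a) • (gammaCLM (n := n) b * cliffordSolve gammaCLM
        (fun a b => (-n : ℝ) • g.frameCurv (σ.frame i) gammaCLM a b (γ t)) a)) t₀ :=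
    tendsto_finsetSum _ fun b _ => tendsto_finsetSum _ fun a _ =>
      ((hv b).mul (hv a)).smul (continuousAt_const.mul (hC a))
  obtain ⟨δ₁, hδ₁, h₁⟩ := Metric.eventually_nhds_iff_ball.1 hev
  obtain ⟨δ₂, hδ₂, h₂⟩ := exists_ball_eq_zero_of_linear_system hA' hC'
    (hev.mono fun t h => (hsys t h).1) (hev.mono fun t h => (hsys t h).2)
  refine ⟨min δ₁ δ₂, lt_min hδ₁ hδ₂, fun t ht =>
    h₁ t (Metric.ball_subset_ball (min_le_left _ _) ht), fun t₁ ht₁ hz hw t ht => ?_⟩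
  have hU₁ := (h₁ t₁ (Metric.ball_subset_ball (min_le_left _ _) ht₁)).2
  rw [mem_zeroSet_iff (h₁ t (Metric.ball_subset_ball (min_le_left _ _) ht)).2]
  refine h₂ t₁ (Metric.ball_subset_ball (min_le_right _ _) ht₁) (hz i hU₁) ?_ t
    (Metric.ball_subset_ball (min_le_right _ _) ht)
  rw [← φ.dirac_eq_frameDirac hU₁, ← σ.clifford_eq_sum, hw]

lemma IsConformalKilling.eventually_mem_zeroSet (hφ : φ.IsConformalKilling) (hn : 3 ≤ n)
    {γ : ℝ → M} {I : Set ℝ} (hI : IsOpen I) (hγ : g.IsGeodesicOn γ I) {i : ι} {t : ℝ}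
    (ht : t ∈ I) (hU : γ t ∈ σ.U i) (hz : γ t ∈ φ.zeroSet)
    (hw : σ.clifford i (γ t) (velocity n γ t) (φ.dirac i (γ t)) = 0) :
    ∀ᶠ s in 𝓝 t, γ s ∈ φ.zeroSet := by
  obtain ⟨δ, hδ, -, h⟩ := hφ.exists_ball_mem_zeroSet hn hI hγ ht hU
  exact Metric.eventually_nhds_iff_ball.2 ⟨δ, hδ, h t (Metric.mem_ball_self hδ) hz hw⟩

/-- At a zero the connection term drops out, so the derivative of the local representative along γ
is a nonzero multiple of γ' · 𝒟φ; a curve with nonzero derivative leaves its value at once. -/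
lemma IsConformalKilling.eventually_notMem_zeroSet (hφ : φ.IsConformalKilling) (hn : 3 ≤ n)
    {γ : ℝ → M} {I : Set ℝ} (hI : IsOpen I) (hγ : g.IsGeodesicOn γ I) {i : ι} {t : ℝ}
    (ht : t ∈ I) (hU : γ t ∈ σ.U i) (hz : γ t ∈ φ.zeroSet)
    (hw : σ.clifford i (γ t) (velocity n γ t) (φ.dirac i (γ t)) ≠ 0) :
    ∀ᶠ s in 𝓝[≠] t, γ s ∉ φ.zeroSet := by
  have hn0 : (n : ℝ) ≠ 0 := by positivity
  have h := (hφ.hasDerivAt_of_mem_zeroSet hn hI hγ ht hU hz).eventually_ne (c := 0)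
    (smul_ne_zero (by simpa using hn0) hw)
  have hc : ContinuousAt γ t := hγ.contMDiffOn.continuousOn.continuousAt (hI.mem_nhds ht)
  filter_upwards [h, (hc.eventually ((σ.isFrame i).isOpen.mem_nhds hU)).filter_mono
    nhdsWithin_le_nhds] with s hs hsU hsz
  exact hs (hsz i hsU)

/-- If a conformal Killing spinor vanishes near one parameter of a geodesic, then it vanishes
along the geodesic. -/
lemma IsConformalKilling.subset_zeroSet_of_eventually (hφ : φ.IsConformalKilling) (hn : 3 ≤ n)
    {γ : ℝ → M} {I : Set ℝ} (hI : IsOpen I) (hI' : IsPreconnected I) (hγ : g.IsGeodesicOn γ I)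
    {t : ℝ} (ht : t ∈ I) (h : ∀ᶠ s in 𝓝 t, γ s ∈ φ.zeroSet) :
    ∀ s ∈ I, γ s ∈ φ.zeroSet := by
  have key : I ⊆ {s | ∀ᶠ r in 𝓝 s, γ r ∈ φ.zeroSet} := by
    -- The parameters near which φ vanishes form an open set; it remains to see that it is
    -- relatively closed in `I`.
    refine hI'.subset_of_closure_inter_subset isOpen_setOfPred_eventually_nhds ⟨t, ht, h⟩ ?_
    rintro s ⟨hs, hsI⟩
    obtain ⟨i, hi⟩ := σ.cover (γ s)
    obtain ⟨δ, hδ, hb, hball⟩ := hφ.exists_ball_mem_zeroSet hn hI hγ hsI hi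
    obtain ⟨r, hr, hrz⟩ := mem_closure_iff_nhds.1 hs _ (Metric.ball_mem_nhds s hδ)
    obtain ⟨hrI, hrU⟩ := hb r hr
    refine Metric.eventually_nhds_iff_ball.2 ⟨δ, hδ, hball r hr hrz.self_of_nhds ?_⟩
    -- φ vanishes on a whole neighbourhood of `r`, so `r` is not an isolated zero and γ' · 𝒟φ must
    -- vanish there. Uniqueness from `r` then covers the ball around `s`.
    by_contra hw
    have h1 := hφ.eventually_notMem_zeroSet hn hI hγ hrI hrU hrz.self_of_nhds hw
    obtain ⟨q, hq, hq'⟩ := (h1.and (hrz.filter_mono nhdsWithin_le_nhds)).exists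
    exact hq hq'
  exact fun s hs => (key hs).self_of_nhds

end SpinorField

end Spinors

/-! ### The dichotomy at a zero -/

theorem lemma4 {n : ℕ} (hn : 3 ≤ n) {M : Type*} [TopologicalSpace M] [T2Space M]
    [ChartedSpace (EuclideanSpace ℝ (Fin n)) M] [IsManifold (𝓡 n) ∞ M]
    (g : LorentzianMetric n M) {ι : Type*} (σ : SpinStructure g ι)
    (φ : SpinorField σ) (hφ : φ.IsConformalKilling)
    (I : Set ℝ) (hIopen : IsOpen I) (hIconn : I.OrdConnected) (h0 : (0 : ℝ) ∈ I)
    (γ : ℝ → M) (hγ : g.IsGeodesicOn γ I)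
    (p : M) (hp : p ∈ φ.zeroSet) (hγp : γ 0 = p) (i : ι) (hi : γ 0 ∈ σ.U i) :
    (σ.clifford i (γ 0) (velocity n γ 0) (φ.dirac i (γ 0)) = 0 → γ '' I ⊆ φ.zeroSet) ∧
    (σ.clifford i (γ 0) (velocity n γ 0) (φ.dirac i (γ 0)) ≠ 0 →
      (∃ δ > 0, ∀ t ∈ I, |t| < δ → γ t ∈ φ.zeroSet → t = 0) ∧
      ∀ J ⊆ I, IsCompact J → ∃ U : Set M, IsOpen U ∧ p ∈ U ∧ γ '' J ∩ U ∩ φ.zeroSet ⊆ {p}) := by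
  have hp0 : γ 0 ∈ φ.zeroSet := by rwa [hγp]
  have hI' : IsPreconnected I := hIconn.isPreconnected
  refine ⟨fun hw => ?_, fun hw => ?_⟩
  · rintro _ ⟨t, ht, rfl⟩
    exact hφ.subset_zeroSet_of_eventually hn hIopen hI' hγ h0
      (hφ.eventually_mem_zeroSet hn hIopen hγ h0 hi hp0 hw) t ht
  have hne := hφ.eventually_notMem_zeroSet hn hIopen hγ h0 hi hp0 hw
  constructor
  · obtain ⟨δ, hδ, h⟩ := Metric.eventually_nhds_iff.1 (eventually_nhdsWithin_iff.1 hne)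
    refine ⟨δ, hδ, fun t _ htδ htz => ?_⟩
    by_contra ht0
    exact h (by simpa using htδ) ht0 htz
  · intro J hJI hJ
    have hiso : ∀ t ∈ J, ∀ᶠ s in 𝓝[≠] t, γ s ∉ φ.zeroSet := by
      intro t ht
      obtain ⟨j, hj⟩ := σ.cover (γ t)
      by_cases htz : γ t ∈ φ.zeroSet
      -- If γ' · 𝒟φ vanished at this zero, φ would vanish along all of γ, contradicting the
      -- isolation of the zero at parameter 0.
      · refine hφ.eventually_notMem_zeroSet hn hIopen hγ (hJI ht) hj htz fun hw' => ?_
        have hall := hφ.subset_zeroSet_of_eventually hn hIopen hI' hγ (hJI ht)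
          (hφ.eventually_mem_zeroSet hn hIopen hγ (hJI ht) hj htz hw')
        obtain ⟨s, hs, hs'⟩ := (hne.and ((hIopen.eventually_mem h0).filter_mono
          nhdsWithin_le_nhds)).exists
        exact hs (hall s hs')
      · have hjO := (σ.isFrame j).isOpen
        have hc : ContinuousAt γ t :=
          hγ.contMDiffOn.continuousOn.continuousAt (hIopen.mem_nhds (hJI ht))
        have hc' : ContinuousAt (fun s => φ.loc j (γ s)) t :=
          ((φ.smooth j).continuousOn.continuousAt (hjO.mem_nhds hj)).comp hc
        rw [SpinorField.mem_zeroSet_iff hj] at htz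
        filter_upwards [(hc'.eventually_ne htz).filter_mono nhdsWithin_le_nhds,
          (hc.eventually (hjO.mem_nhds hj)).filter_mono nhdsWithin_le_nhds] with s hs hsU hsz
        exact hs (hsz j hsU)
    -- Infinitely many zeros would accumulate at a parameter of the compact set `J`, against `hiso`.
    have hfin : {t ∈ J | γ t ∈ φ.zeroSet}.Finite := by
      by_contra hinf
      obtain ⟨t, ht, hacc⟩ := Set.Infinite.exists_accPt_of_subset_isCompact hinf hJ
        (Set.sep_subset _ _)
      obtain ⟨s, hs, hs'⟩ := ((accPt_iff_frequently_nhdsNE.1 hacc).and_eventually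
        (hiso t ht)).exists
      exact hs' hs.2
    -- Points of M are removed, not parameters, so it does not matter if γ returns to p at another
    -- parameter. The removed set is finite, hence closed.
    refine ⟨(γ '' {t ∈ J | γ t ∈ φ.zeroSet} \ {p})ᶜ,
      ((hfin.image γ).subset Set.sdiff_subset).isClosed.isOpen_compl, by simp, ?_⟩
    rintro _ ⟨⟨⟨t, ht, rfl⟩, hU⟩, hz⟩
    by_contra hne'
    exact hU ⟨⟨t, ⟨ht, hz⟩, rfl⟩, hne'⟩
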